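/- Let $n\in\mathbb N_0$ and $\alpha>0$. Notation: - For $f\in L^2(\mathbb R)$ let $\hat f$ be its Fourier transform, normalised by $\hat f(\omega)=(2\pi)^{-1/2}\int_{\mathbb R} f(t)e^{-i\omega t}\,dt$ for integrable $f$, and let $H^2(\mathbb R)=\{f\in L^2(\mathbb R):\hat f=0 \text{ a.e. on }(-\infty,0)\}$. - Let $\psi=\psi_n^\alpha\in H^2(\mathbb R)$ be given by $\hat\psi(\omega)=\omega^{\alpha/2}e^{-\omega}L_n^{\alpha}(2\omega)$ for $\omega>0$, where $L_n^\alpha$ is the generalised Laguerre polynomial, and let $C_\psi=\int_0^\infty|\hat\psi(\omega)|^2\,\frac{d\omega}{\omega}$. - On the upper half-plane $\mathbb C^+$ let $d\mu(x+iy)=\frac{1}{2\pi}\frac{dx\,dy}{y^2}$ (this is the normalisation of the hyperbolic measure for which the wavelet orthogonality relation $\int_{\mathbb C^+}|W_\psi f|^2\,d\mu=C_\psi\|f\|_2^2$ holds), and write $|\Omega|=\mu(\Omega)$. For $f\in H^2(\mathbb R)$ let $W_\psi f(b+ia)=\int_{\mathbb R}f(t)\,\overline{a^{-1/2}\psi\big(\tfrac{t-b}{a}\big)}\,dt$,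 and let $\mathcal W_\psi=W_\psi(H^2(\mathbb R))\subset L^2(\mathbb C^+,\mu)$. - For $m=\begin{pmatrix}a&b\\c&d\end{pmatrix}\in \mathrm{SL}(2,\mathbb R)$ let $\tau_n^\alpha(m^{-1})F(z)=\Big(\frac{|cz+d|}{cz+d}\Big)^{2n+\alpha+1}F(m\cdot z)$ (principal branch). Replacing $m$ by $-m$ changes this only by a unimodular constant; elements of $\mathrm{PSL}(2,\mathbb R)$ act through an arbitrary choice of representatives. Theorem. Let $\Gamma\subset\mathrm{PSL}(2,\mathbb R)$ be a Fuchsian group (a discrete subgroup) with a fundamental domain $\Omega\subset\mathbb C^+$ of finite measure, and let $F\in\mathcal W_{\psi}$. Then $\frac{C_{\psi}}{\|\psi\|_2^2}=\frac2\alpha$, and: 1. if $\{\tau_n^\alpha(\gamma)F\}_{\gamma\in\Gamma}$ is a frame for $\mathcal W_{\psi}$, then $|\Omega|\le\frac{C_{\psi}}{\|\psi\|_2^2}=\frac2\alpha$; 2. if $\{\tau_n^\alpha(\gamma)F\}_{\gamma\in\Gamma}$ is a Riesz sequence in $L^2(\mathbb C^+,\mu)$, then $|\Omega|\ge\frac{C_{\psi}}{\|\psi\|_2^2}=\frac2\alpha$.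 (In terms of the hyperbolic area $dx\,dy/y^2$, the constant $2/\alpha$ reads $4\pi/\alpha$.) -/

import Mathlib

open MeasureTheory Set
open scoped MatrixGroups UpperHalfPlane FourierTransform

noncomputable section

namespace WaveletDensity

/-! ### The action of `PSL(2, ℝ)` on the upper half-plane and the invariant measure -/

theorem center_le_ker :
    Subgroup.center SL(2, ℝ) ≤ (MulAction.toPermHom SL(2, ℝ) ℍ).ker := by
  intro g hg
  obtain ⟨r, hr, hg'⟩ := Matrix.SpecialLinearGroup.mem_center_iff.mp hg
  have hr2 : r ^ 2 = 1 := by simpa using hr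
  rw [MonoidHom.mem_ker]
  ext1 z
  change g • z = z
  rcases mul_self_eq_one_iff.mp ((sq r).symm.trans hr2) with h | h
  · have : g = 1 := by
      ext i j
      rw [← hg', h]; simp
    rw [this, one_smul]
  · have : g = -1 := by
      ext i j
      rw [← hg', h]
      fin_cases i <;> fin_cases j <;> simp
    rw [this]
    ext1
    simp [UpperHalfPlane.coe_specialLinearGroup_apply]

/-- `PSL(2, ℝ)` acts on the upper half-plane by Möbius transformations, `[m] • z = m • z`. -/
instance pslAction : MulAction PSL(2, ℝ) ℍ :=
  MulAction.compHom ℍ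
    (QuotientGroup.lift (Subgroup.center SL(2, ℝ)) (MulAction.toPermHom SL(2, ℝ) ℍ) center_le_ker)

theorem psl_mk_smul (m : SL(2, ℝ)) (z : ℍ) : ((m : PSL(2, ℝ)) • z) = m • z := rfl

/-- The `PSL(2, ℝ)`-invariant measure `dμ = (2π)⁻¹ y⁻² dx dy` on the upper half-plane (Mathlib's
`volume` on `ℍ` is `y⁻² dx dy`). The factor `(2π)⁻¹` is the normalisation for which the
orthogonality relation `∫ |W_ψ f|² dμ = C_ψ ‖f‖²` holds with the admissibility constant below. -/
def hypMeasure : Measure ℍ := ENNReal.ofReal (2 * Real.pi)⁻¹ • (volume : Measure ℍ)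

/-! ### Hardy space, admissibility constant, wavelet transform -/

/-- The unitary Fourier transform in angular frequency on `L²(ℝ)`, which is
`f̂(ω) = (2π)^(-1/2) ∫ f(t) e^{-iωt} dt` for integrable `f`. Mathlib's `𝓕` uses the
kernel `e^{-2πiξt}`. -/
def angularFourier (f : Lp ℂ 2 (volume : Measure ℝ)) (ω : ℝ) : ℂ :=
  ((√(2 * Real.pi))⁻¹ : ℝ) * (𝓕 f : Lp ℂ 2 (volume : Measure ℝ)) (ω / (2 * Real.pi))

/-- The Hardy space `H²(ℝ)`: all `f ∈ L²(ℝ)` with Fourier transform supported on `[0, ∞)`. -/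
def hardySpace : Set (Lp ℂ 2 (volume : Measure ℝ)) :=
  {f | ∀ᵐ ω : ℝ, ω < 0 → angularFourier f ω = 0}

/-- The admissibility constant `C_ψ = ∫₀^∞ |ψ̂(ω)|² dω / ω`. -/
def admissibilityConst (ψ : Lp ℂ 2 (volume : Measure ℝ)) : ℝ :=
  ∫ ω in Ioi (0 : ℝ), ‖angularFourier ψ ω‖ ^ 2 / ω

/-- The wavelet transform `W_ψ f(b + ia) = ⟨f, ρ(a,b) ψ⟩`, where
`ρ(a,b) ψ(t) = a^(-1/2) ψ((t - b) / a)`. -/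
def waveletTransform (ψ f : Lp ℂ 2 (volume : Measure ℝ)) (z : ℍ) : ℂ :=
  ∫ t : ℝ, f t * star (((√z.im)⁻¹ : ℝ) * ψ ((t - z.re) / z.im))

/-- The wavelet space `𝒲_ψ`, the image of `H²(ℝ)` under the wavelet transform. -/
def waveletSpace (ψ : Lp ℂ 2 (volume : Measure ℝ)) : Set (ℍ → ℂ) :=
  waveletTransform ψ '' hardySpace

/-! ### The special windows `ψ_n^α` -/

/-- The generalised Laguerre polynomial
`L_n^α(x) = ∑_{k ≤ n} (-1)^k binom(n + α, n - k) x^k / k!` for `α > 0`. -/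
def laguerre (n : ℕ) (α x : ℝ) : ℝ :=
  ∑ k ∈ Finset.range (n + 1),
    (-1) ^ k * (Real.Gamma (n + α + 1) / (Real.Gamma (k + α + 1) * (n - k).factorial)) *
      (x ^ k / k.factorial)

/-- The Fourier transform (angular frequency) of the window `ψ_n^α`:
`ω^(α/2) e^(-ω) L_n^α(2ω)` for `ω > 0`, and `0` for `ω ≤ 0`. -/
def psiHat (n : ℕ) (α : ℝ) : ℝ → ℂ :=
  (Ioi (0 : ℝ)).indicator fun ω => ((ω ^ (α / 2) * Real.exp (-ω) * laguerre n α (2 * ω) : ℝ) : ℂ)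

theorem memLp_psiHat (n : ℕ) {α : ℝ} (hα : 0 < α) : MemLp (psiHat n α) 2 volume := by
  have key : ∀ k : ℕ, MemLp ((Ioi (0 : ℝ)).indicator
      fun ω => ((ω ^ (α / 2 + k) * Real.exp (-ω) : ℝ) : ℂ)) 2 volume := by
    intro k
    rw [memLp_indicator_iff_restrict measurableSet_Ioi]
    have hmeas : AEStronglyMeasurable
        (fun ω : ℝ => ((ω ^ (α / 2 + k) * Real.exp (-ω) : ℝ) : ℂ))
        (volume.restrict (Ioi 0)) := by
      apply Measurable.aestronglyMeasurable
      fun_prop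
    rw [memLp_two_iff_integrable_sq_norm hmeas]
    have h := integrableOn_rpow_mul_exp_neg_mul_rpow (s := α + 2 * k) (p := 1) (b := 2)
      (by have : (0 : ℝ) ≤ k := k.cast_nonneg
          linarith) one_pos (by norm_num)
    refine IntegrableOn.congr_fun h (fun ω hω => ?_) measurableSet_Ioi
    have hω' : (0 : ℝ) < ω := hω
    simp only [Real.rpow_one]
    rw [Complex.norm_real, Real.norm_eq_abs, sq_abs, mul_pow, ← Real.exp_nat_mul,
      ← Real.rpow_natCast, ← Real.rpow_mul hω'.le]
    congr 2 <;> push_cast <;> ring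
  have hsum : psiHat n α = fun ω => ∑ k ∈ Finset.range (n + 1),
      (((-1) ^ k * (Real.Gamma (n + α + 1) / (Real.Gamma (k + α + 1) * (n - k).factorial)) *
        (2 ^ k / k.factorial) : ℝ) : ℂ) • (Ioi (0 : ℝ)).indicator
        (fun ω => ((ω ^ (α / 2 + k) * Real.exp (-ω) : ℝ) : ℂ)) ω := by
    funext ω
    by_cases hω : ω ∈ Ioi (0 : ℝ)
    · simp only [psiHat, laguerre, indicator_of_mem hω, smul_eq_mul]
      rw [Finset.mul_sum, Complex.ofReal_sum]
      refine Finset.sum_congr rfl fun k _ => ?_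
      rw [Real.rpow_add hω, Real.rpow_natCast, mul_pow]
      push_cast
      ring
    · simp only [psiHat, indicator_of_notMem hω, smul_zero, Finset.sum_const_zero]
  rw [hsum]
  refine memLp_finsetSum _ fun k _ => ?_
  exact MemLp.const_smul (key k) (_ : ℂ)

/-- `ψ̂_n^α` in the frequency variable of `𝓕`. -/
theorem memLp_psiHat_scaled (n : ℕ) {α : ℝ} (hα : 0 < α) :
    MemLp (fun ξ : ℝ => ((√(2 * Real.pi) : ℝ) : ℂ) * psiHat n α (2 * Real.pi * ξ)) 2 volume := by
  refine MemLp.const_mul ?_ _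
  have h := memLp_psiHat n hα
  have hq : Measurable (psiHat n α) := by
    unfold psiHat laguerre
    refine Measurable.indicator ?_ measurableSet_Ioi
    fun_prop
  have hm : AEStronglyMeasurable (fun ξ : ℝ => psiHat n α (2 * Real.pi * ξ)) volume :=
    (hq.comp (measurable_const_mul _)).aestronglyMeasurable
  rw [memLp_two_iff_integrable_sq_norm h.1] at h
  rw [memLp_two_iff_integrable_sq_norm hm]
  exact h.comp_mul_left' (g := fun ω => ‖psiHat n α ω‖ ^ 2) (by positivity)

/-- The window `ψ_n^α ∈ L²(ℝ)`, given by `angularFourier ψ_n^α = psiHat n α`. -/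
def psi (n : ℕ) (α : ℝ) (hα : 0 < α) : Lp ℂ 2 (volume : Measure ℝ) :=
  𝓕⁻ ((memLp_psiHat_scaled n hα).toLp _)

/-! ### The projective representation -/

/-- For `m = !![a, b; c, d]`,
`(τ_n^α(m⁻¹) F)(z) = (|cz + d| / (cz + d)) ^ (2n + α + 1) * F(m • z)`, with the principal branch of
the power. Replacing `m` by `-m` multiplies this function by a unimodular constant. -/
def tau (n : ℕ) (α : ℝ) (g : SL(2, ℝ)) (F : ℍ → ℂ) (z : ℍ) : ℂ :=
  let m := g⁻¹
  let j : ℂ := (m 1 0 : ℂ) * z + (m 1 1 : ℂ)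
  (((‖j‖ : ℝ) : ℂ) / j) ^ ((2 * n + α + 1 : ℝ) : ℂ) * F (m • z)

/-! ### Frames and Riesz sequences in `L²(ℍ, μ)` -/

/-- The inner product of `L²(ℍ, μ)`. -/
def l2Inner (F G : ℍ → ℂ) : ℂ := ∫ z, F z * star (G z) ∂hypMeasure

/-- The squared norm of `L²(ℍ, μ)`. -/
def l2NormSq (F : ℍ → ℂ) : ℝ := ∫ z, ‖F z‖ ^ 2 ∂hypMeasure

/-- The frame inequalities `A ‖H‖² ≤ ∑ |⟨H, g_i⟩|² ≤ B ‖H‖²` for all `H` in the space `V`.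
That the `g_i` lie in `V` is not made a requirement: the families considered below are orbits in the
invariant space `𝒲`, where membership is automatic. -/
def IsFrame {ι : Type*} (V : Set (ℍ → ℂ)) (g : ι → ℍ → ℂ) : Prop :=
  ∃ A B : ℝ, 0 < A ∧ 0 < B ∧ ∀ H ∈ V,
    Summable (fun i => ‖l2Inner H (g i)‖ ^ 2) ∧
    A * l2NormSq H ≤ ∑' i, ‖l2Inner H (g i)‖ ^ 2 ∧
    ∑' i, ‖l2Inner H (g i)‖ ^ 2 ≤ B * l2NormSq H

/-- The Riesz sequence inequalities `A ∑ |c_i|² ≤ ‖∑ c_i g_i‖² ≤ B ∑ |c_i|²` for all finitely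
supported families of coefficients `c`. -/
def IsRieszSequence {ι : Type*} (g : ι → ℍ → ℂ) : Prop :=
  ∃ A B : ℝ, 0 < A ∧ 0 < B ∧ ∀ c : ι →₀ ℂ,
    A * c.sum (fun _ x => ‖x‖ ^ 2) ≤ l2NormSq (fun z => c.sum fun i x => x * g i z) ∧
    l2NormSq (fun z => c.sum fun i x => x * g i z) ≤ B * c.sum (fun _ x => ‖x‖ ^ 2)

end WaveletDensity

end

/-!
Under the Fourier transform the wavelet space `𝒲_ψ` is the range of `freqTransform`, that is of
`φ ↦ (z ↦ ⟪κ_z, φ⟫)` on `L²(0, ∞)`, where `κ_z` (`kernelVec`) is the wavelet at the point `z`. Two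
facts turn the theorem into a counting argument: `‖κ_z‖² = ‖ψ‖²` does not depend on `z`
(`norm_sq_kernelVec`), and `∫ |⟪κ_z, φ⟫|² dμ(z) = C_ψ ‖φ‖²` (`lintegral_enorm_sq_freqTransform`),
which is Plancherel's theorem on horizontal lines followed by the invariance of `dy / y`.

The action `τ` is transported to isometries `U g` of `L²(0, ∞)`, multiplicative up to phase
(`exists_tauOp`, `tau_tau`). The point is that `τ` maps `𝒲_ψ` into itself. It is enough to see this
on a total set. The functions `ξ^(α/2) e^(2πiwξ)`, `w ∈ ℍ`, are total (`span_expVec_dense`), and by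
a Laplace transform the transform of such a function is, up to a constant, equal to
`y^((α+1)/2) s^(-(α+1)) ((w + z̄) / (w + z))^n` with `s = -2πi(w + z)` (`freqTransform_expVec`).
Möbius transformations permute these expressions up to the automorphy factor
(`autFactor_mul_expTransform`). Branches of powers are controlled by continuous logarithms on the
connected space `ℍ` (`eq_of_exp_eq`).

For any vector `h`, unfolding the orthogonality relation over the fundamental domain gives
`C_ψ ‖h‖² = ∫_Ω ∑_γ |⟪U_γ h, κ_z⟫|² dμ(z)` (`admissibilityConst_mul_norm_sq`).

* If the orbit of `f` is a frame with frame operator `S`, then `S` commutes with the `U_γ`, so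
  the orbit of `h = S^(-1/2) f` is a Parseval frame, and `‖h‖ ≤ 1` (`exists_parseval_window`). The
  integrand is then `‖κ_z‖² = ‖ψ‖²`, and so `|Ω| ‖ψ‖² = C_ψ ‖h‖² ≤ C_ψ`.
* If the orbit of `f` is a Riesz sequence, the same construction on its closed span gives an
  orthonormal orbit of a unit vector `h` (`exists_orthonormal_window`). Bessel's inequality bounds
  the integrand by `‖ψ‖²`, and so `C_ψ ≤ |Ω| ‖ψ‖²`.

The value `C_ψ / ‖ψ‖² = 2 / α` comes from integrating `ω^(α-1) e^(-2ω) L(2ω)²` by parts; the term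
with the derivative of `L` vanishes by orthogonality of Laguerre polynomials
(`integral_laguerrePoly_sq`).
-/

noncomputable section

namespace WaveletDensity

/-! ### Frames, Riesz sequences and their canonical Parseval frames -/

section HilbertFrames

open ContinuousLinearMap Filter Topology
open scoped InnerProductSpace

variable {ι H : Type*} [NormedAddCommGroup H] [InnerProductSpace ℂ H]

/-- The analysis operator `f ↦ (⟪e i, f⟫)_i` of a Bessel family `e` with Bessel bound `B`. -/
def analysisOp (e : ι → H) {B : ℝ}
    (hB : ∀ f, Summable (fun i => ‖⟪e i, f⟫_ℂ‖ ^ 2) ∧ ∑' i, ‖⟪e i, f⟫_ℂ‖ ^ 2 ≤ B * ‖f‖ ^ 2) :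
    H →L[ℂ] lp (fun _ : ι => ℂ) 2 :=
  LinearMap.mkContinuous
    { toFun := fun f => ⟨fun i => ⟪e i, f⟫_ℂ, memℓp_gen (by simpa using (hB f).1)⟩
      map_add' := fun f g => Subtype.ext (funext fun i => inner_add_right _ _ _)
      map_smul' := fun c f => Subtype.ext (funext fun i => inner_smul_right _ _ _) } (√B)
    (fun f => by
      refine lp.norm_le_of_tsum_le (by simp) (by positivity) ?_
      have h := (hB f).2
      have h0 : 0 ≤ ∑' i, ‖⟪e i, f⟫_ℂ‖ ^ 2 := tsum_nonneg fun i => by positivity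
      have : (√B * ‖f‖) ^ 2 = B * ‖f‖ ^ 2 := by
        rcases le_or_gt 0 B with hB0 | hB0
        · rw [mul_pow, Real.sq_sqrt hB0]
        · have : B * ‖f‖ ^ 2 ≤ 0 := mul_nonpos_of_nonpos_of_nonneg hB0.le (by positivity)
          rw [Real.sqrt_eq_zero_of_nonpos hB0.le]
          linarith
      simpa [this] using h)

theorem analysisOp_apply (e : ι → H) {B : ℝ}
    (hB : ∀ f, Summable (fun i => ‖⟪e i, f⟫_ℂ‖ ^ 2) ∧ ∑' i, ‖⟪e i, f⟫_ℂ‖ ^ 2 ≤ B * ‖f‖ ^ 2)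
    (f : H) (i : ι) : analysisOp e hB f i = ⟪e i, f⟫_ℂ := rfl

/-- Every Bessel family has a frame operator `S f = ∑ ⟪e i, f⟫ e i`, the series converging in
norm. -/
theorem exists_frameOp [CompleteSpace H] (e : ι → H) {B : ℝ}
    (hB : ∀ f, Summable (fun i => ‖⟪e i, f⟫_ℂ‖ ^ 2) ∧ ∑' i, ‖⟪e i, f⟫_ℂ‖ ^ 2 ≤ B * ‖f‖ ^ 2) :
    ∃ S : H →L[ℂ] H, ∀ f, HasSum (fun i => ⟪e i, f⟫_ℂ • e i) (S f) := by
  classical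
  refine ⟨adjoint (analysisOp e hB) ∘L analysisOp e hB, fun f => ?_⟩
  have h := (lp.hasSum_single (p := 2) (by simp) (analysisOp e hB f)).mapL
    (adjoint (analysisOp e hB))
  convert! h using 2 with i
  refine ext_inner_left ℂ fun v => ?_
  rw [inner_smul_right, adjoint_inner_right, lp.inner_single_right, analysisOp_apply,
    analysisOp_apply]
  simp [mul_comm]

variable {e : ι → H} {S : H →L[ℂ] H}

theorem hasSum_inner_frameOp (hS : ∀ f, HasSum (fun i => ⟪e i, f⟫_ℂ • e i) (S f)) (x y : H) :
    HasSum (fun i => ⟪x, e i⟫_ℂ * ⟪e i, y⟫_ℂ) ⟪x, S y⟫_ℂ := by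
  simpa [inner_smul_right, mul_comm] using (hS y).mapL (innerSL ℂ x)

theorem hasSum_norm_sq_frameOp (hS : ∀ f, HasSum (fun i => ⟪e i, f⟫_ℂ • e i) (S f)) (x : H) :
    HasSum (fun i => ‖⟪e i, x⟫_ℂ‖ ^ 2) (⟪x, S x⟫_ℂ).re := by
  convert! (hasSum_inner_frameOp hS x x).mapL Complex.reCLM using 2 with i
  rw [← inner_conj_symm x, Complex.reCLM_apply, ← Complex.normSq_eq_conj_mul_self,
    Complex.ofReal_re, Complex.normSq_eq_norm_sq]

/-- An isometry that permutes a Bessel family up to phase factors commutes with its frame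
operator. -/
theorem frameOp_commute [CompleteSpace H]
    (hS : ∀ f, HasSum (fun i => ⟪e i, f⟫_ℂ • e i) (S f))
    {U : H →L[ℂ] H} (hU : ∀ x y, ⟪U x, U y⟫_ℂ = ⟪x, y⟫_ℂ)
    (hperm : ∃ (p : Equiv.Perm ι) (c : ι → ℂ), ∀ i, ‖c i‖ = 1 ∧ U (e i) = c i • e (p i)) :
    Commute S U := by
  obtain ⟨p, c, hc⟩ := hperm
  refine ContinuousLinearMap.ext fun y => ext_inner_left ℂ fun x => ?_
  have h1 := p.hasSum_iff.mpr (hasSum_inner_frameOp hS x (U y))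
  have h2 := hasSum_inner_frameOp hS (adjoint U x) y
  rw [adjoint_inner_left] at h2
  refine h1.unique ?_
  convert! h2 using 2 with i
  rw [adjoint_inner_left, (hc i).2, ← hU (e i) y, (hc i).2, inner_smul_left, inner_smul_right]
  have : (starRingEnd ℂ) (c i) * c i = 1 := by
    rw [← Complex.normSq_eq_conj_mul_self, Complex.normSq_eq_norm_sq, (hc i).1]; simp
  simp only [Function.comp_apply]
  linear_combination (-⟪x, e (p i)⟫_ℂ * ⟪e (p i), U y⟫_ℂ) * this

/-- The inverse square root `R = S^(-1/2)` of the frame operator of a frame. -/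
theorem exists_invSqrt_frameOp [CompleteSpace H]
    (hS : ∀ f, HasSum (fun i => ⟪e i, f⟫_ℂ • e i) (S f)) {A : ℝ} (hA : 0 < A)
    (hlow : ∀ f, A * ‖f‖ ^ 2 ≤ ∑' i, ‖⟪e i, f⟫_ℂ‖ ^ 2) :
    ∃ R : H →L[ℂ] H, (∀ x y, ⟪R x, y⟫_ℂ = ⟪x, R y⟫_ℂ) ∧ (∀ x, R (S (R x)) = x) ∧
      (∀ x, S (R (R x)) = x) ∧ ∀ U, Commute S U → Commute R U := by
  have hre : ∀ f, A * ‖f‖ ^ 2 ≤ (⟪f, S f⟫_ℂ).re := fun f =>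
    (hlow f).trans_eq (hasSum_norm_sq_frameOp hS f).tsum_eq
  have hsym : ∀ x y, ⟪S x, y⟫_ℂ = ⟪x, S y⟫_ℂ := fun x y => by
    have h := (hasSum_inner_frameOp hS y x).map (starRingEnd ℂ) Complex.continuous_conj
    rw [inner_conj_symm] at h
    refine h.unique ?_
    convert! hasSum_inner_frameOp hS x y using 2 with i
    simp [mul_comm]
  obtain ⟨u, hu⟩ : IsUnit S := by
    refine isUnit_of_forall_le_norm_inner_map S (c := ⟨A, hA.le⟩) hA fun x => ?_
    rw [hsym]
    exact (mul_comm _ _).trans_le ((hre x).trans (Complex.re_le_norm _))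
  have hSu : ∀ x, S ((↑u⁻¹ : H →L[ℂ] H) x) = x := fun x => by
    rw [← hu]
    exact congrArg (fun T : H →L[ℂ] H => T x) u.mul_inv
  have hinv : (0 : H →L[ℂ] H) ≤ ↑u⁻¹ := by
    rw [nonneg_iff_isPositive]
    refine ⟨fun x y => ?_, fun x => ?_⟩
    · change ⟪(↑u⁻¹ : H →L[ℂ] H) x, y⟫_ℂ = ⟪x, (↑u⁻¹ : H →L[ℂ] H) y⟫_ℂ
      conv_lhs => rw [← hSu y, ← hsym, hSu]
    · change 0 ≤ RCLike.re ⟪(↑u⁻¹ : H →L[ℂ] H) x, x⟫_ℂ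
      have h := hre ((↑u⁻¹ : H →L[ℂ] H) x)
      rw [hSu] at h
      exact le_trans (by positivity) h
  set R : H →L[ℂ] H := CFC.sqrt ↑u⁻¹ with hR
  have hRR : R * R = ↑u⁻¹ := CFC.sqrt_mul_sqrt_self _ hinv
  have hcomm : ∀ U, Commute S U → Commute R U := fun U hSU => by
    have h1 : Commute (↑u⁻¹ : H →L[ℂ] H) U := by
      rw [← hu] at hSU
      exact hSU.units_inv_left
    rw [hR, CFC.sqrt_eq_cfc]
    exact Commute.cfc_nnreal h1 _
  have hRS : S * R = R * S := (hcomm S (Commute.refl S)).symm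
  have hSRR : ∀ x, S (R (R x)) = x := fun x => by
    have := hSu x
    rwa [← hRR] at this
  refine ⟨R, fun x y => ?_, fun x => ?_, hSRR, hcomm⟩
  · exact ((nonneg_iff_isPositive R).mp (CFC.sqrt_nonneg _)).isSymmetric x y
  · have := congrArg (fun T : H →L[ℂ] H => T (R x)) hRS
    exact this.symm.trans (hSRR x)

/-- The canonical Parseval frame of a frame that is an orbit of isometries: the frame vectors are
the images of a single vector of norm at most one. -/
theorem exists_parseval_window [CompleteSpace H] [Nonempty ι] {U : ι → H →L[ℂ] H} {f : H}
    (hU : ∀ i x y, ⟪U i x, U i y⟫_ℂ = ⟪x, y⟫_ℂ)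
    (hperm : ∀ j, ∃ (p : Equiv.Perm ι) (c : ι → ℂ), ∀ i, ‖c i‖ = 1 ∧
      U j (U i f) = c i • U (p i) f)
    {A B : ℝ} (hA : 0 < A)
    (hframe : ∀ x, Summable (fun i => ‖⟪U i f, x⟫_ℂ‖ ^ 2) ∧
      A * ‖x‖ ^ 2 ≤ ∑' i, ‖⟪U i f, x⟫_ℂ‖ ^ 2 ∧ ∑' i, ‖⟪U i f, x⟫_ℂ‖ ^ 2 ≤ B * ‖x‖ ^ 2) :
    ∃ S R : H →L[ℂ] H, (∀ x, HasSum (fun i => ⟪U i f, x⟫_ℂ • U i f) (S x)) ∧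
      (∀ x y, ⟪R x, y⟫_ℂ = ⟪x, R y⟫_ℂ) ∧ (∀ x, S (R (R x)) = x) ∧
      (∀ x, HasSum (fun i => ‖⟪U i (R f), x⟫_ℂ‖ ^ 2) (‖x‖ ^ 2)) ∧ ‖R f‖ ≤ 1 := by
  obtain ⟨S, hS⟩ := exists_frameOp (fun i => U i f) (fun x => ⟨(hframe x).1, (hframe x).2.2⟩)
  obtain ⟨R, hsym, hRSR, hSRR, hcomm⟩ := exists_invSqrt_frameOp hS hA fun x => (hframe x).2.1
  have hRU : ∀ i x, U i (R x) = R (U i x) := fun i x =>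
    (congrArg (fun T : H →L[ℂ] H => T x)
      (hcomm (U i) (frameOp_commute hS (hU i) (hperm i)))).symm
  have hpars : ∀ x, HasSum (fun i => ‖⟪U i (R f), x⟫_ℂ‖ ^ 2) (‖x‖ ^ 2) := fun x => by
    have h := hasSum_norm_sq_frameOp hS (R x)
    rw [hsym, hRSR, inner_self_eq_norm_sq_to_K] at h
    simp only [← hsym, ← hRU] at h
    norm_cast at h
  refine ⟨S, R, hS, hsym, hSRR, hpars, ?_⟩
  obtain ⟨i⟩ := ‹Nonempty ι›
  have hnorm : ‖U i (R f)‖ = ‖R f‖ := by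
    rw [norm_eq_sqrt_re_inner (𝕜 := ℂ), hU, ← norm_eq_sqrt_re_inner]
  have h := le_hasSum (hpars (U i (R f))) i fun _ _ => by positivity
  rw [inner_self_eq_norm_sq_to_K, hnorm] at h
  norm_num at h
  by_contra! hlt
  have h1 : 1 < ‖R f‖ ^ 2 := one_lt_pow₀ hlt two_ne_zero
  nlinarith

theorem riesz_finset {A B : ℝ} (hR : ∀ c : ι →₀ ℂ,
      A * c.sum (fun _ x => ‖x‖ ^ 2) ≤ ‖c.sum fun i x => x • e i‖ ^ 2 ∧
      ‖c.sum fun i x => x • e i‖ ^ 2 ≤ B * c.sum (fun _ x => ‖x‖ ^ 2))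
    (s : Finset ι) (c : ι → ℂ) :
    A * ∑ i ∈ s, ‖c i‖ ^ 2 ≤ ‖∑ i ∈ s, c i • e i‖ ^ 2 ∧
      ‖∑ i ∈ s, c i • e i‖ ^ 2 ≤ B * ∑ i ∈ s, ‖c i‖ ^ 2 := by
  classical
  have h := hR (Finsupp.onFinset s (fun i => if i ∈ s then c i else 0) (by simp +contextual))
  rw [Finsupp.onFinset_sum _ (by simp), Finsupp.onFinset_sum _ (by simp)] at h
  have h1 : ∑ i ∈ s, ‖if i ∈ s then c i else 0‖ ^ 2 = ∑ i ∈ s, ‖c i‖ ^ 2 :=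
    Finset.sum_congr rfl fun i hi => by rw [if_pos hi]
  have h2 : ∑ i ∈ s, (if i ∈ s then c i else 0) • e i = ∑ i ∈ s, c i • e i :=
    Finset.sum_congr rfl fun i hi => by rw [if_pos hi]
  rwa [h1, h2] at h

/-- By duality, the upper Riesz inequality gives the Bessel inequality. -/
theorem bessel_of_riesz {B : ℝ} (hB : 0 ≤ B)
    (hR : ∀ (s : Finset ι) (c : ι → ℂ), ‖∑ i ∈ s, c i • e i‖ ^ 2 ≤ B * ∑ i ∈ s, ‖c i‖ ^ 2)
    (f : H) :
    Summable (fun i => ‖⟪e i, f⟫_ℂ‖ ^ 2) ∧ ∑' i, ‖⟪e i, f⟫_ℂ‖ ^ 2 ≤ B * ‖f‖ ^ 2 := by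
  have key : ∀ s : Finset ι, ∑ i ∈ s, ‖⟪e i, f⟫_ℂ‖ ^ 2 ≤ B * ‖f‖ ^ 2 := fun s => by
    set v := ∑ i ∈ s, ⟪e i, f⟫_ℂ • e i with hv
    have h1 : ⟪v, f⟫_ℂ = ((∑ i ∈ s, ‖⟪e i, f⟫_ℂ‖ ^ 2 : ℝ) : ℂ) := by
      rw [hv, sum_inner, Complex.ofReal_sum]
      refine Finset.sum_congr rfl fun i _ => ?_
      rw [inner_smul_left, ← Complex.normSq_eq_conj_mul_self, Complex.normSq_eq_norm_sq]
    have h2 := hR s fun i => ⟪e i, f⟫_ℂ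
    set σ := ∑ i ∈ s, ‖⟪e i, f⟫_ℂ‖ ^ 2 with hσ
    have h0 : 0 ≤ σ := Finset.sum_nonneg fun i _ => by positivity
    have h3 : σ ≤ ‖v‖ * ‖f‖ := by
      have := norm_inner_le_norm (𝕜 := ℂ) v f
      rwa [h1, Complex.norm_real, Real.norm_of_nonneg h0] at this
    have h4 : σ * σ ≤ σ * (B * ‖f‖ ^ 2) := by
      calc σ * σ ≤ (‖v‖ * ‖f‖) * (‖v‖ * ‖f‖) := mul_self_le_mul_self h0 h3
        _ = ‖v‖ ^ 2 * ‖f‖ ^ 2 := by ring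
        _ ≤ (B * σ) * ‖f‖ ^ 2 := by gcongr
        _ = _ := by ring
    rcases h0.eq_or_lt with h | h
    · rw [← h]
      positivity
    · exact le_of_mul_le_mul_left h4 h
  have hs := summable_of_sum_le (fun i => by positivity) key
  exact ⟨hs, hs.tsum_le_of_sum_le key⟩

/-- By duality, the lower Riesz inequality gives the lower frame inequality on the closed span. -/
theorem lower_frame_of_riesz [CompleteSpace H] {A B : ℝ} (hA : 0 < A)
    (hR : ∀ (s : Finset ι) (c : ι → ℂ), A * ∑ i ∈ s, ‖c i‖ ^ 2 ≤ ‖∑ i ∈ s, c i • e i‖ ^ 2)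
    (hB : ∀ f, Summable (fun i => ‖⟪e i, f⟫_ℂ‖ ^ 2) ∧ ∑' i, ‖⟪e i, f⟫_ℂ‖ ^ 2 ≤ B * ‖f‖ ^ 2)
    {f : H} (hf : f ∈ (Submodule.span ℂ (range e)).topologicalClosure) :
    A * ‖f‖ ^ 2 ≤ ∑' i, ‖⟪e i, f⟫_ℂ‖ ^ 2 := by
  obtain ⟨S, hS⟩ := exists_frameOp e hB
  have hre : ∀ f, ∑' i, ‖⟪e i, f⟫_ℂ‖ ^ 2 = (⟪f, S f⟫_ℂ).re := fun f =>
    (hasSum_norm_sq_frameOp hS f).tsum_eq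
  have hcl : IsClosed {f : H | A * ‖f‖ ^ 2 ≤ ∑' i, ‖⟪e i, f⟫_ℂ‖ ^ 2} := by
    simp only [hre]
    exact isClosed_le (by fun_prop) (by fun_prop)
  refine closure_minimal (fun f hf => ?_) hcl hf
  obtain ⟨c, rfl⟩ := Finsupp.mem_span_range_iff_exists_finsupp.mp hf
  rw [Finsupp.sum]
  set s := c.support
  set v := ∑ i ∈ s, c i • e i with hv
  change A * ‖v‖ ^ 2 ≤ ∑' i, ‖⟪e i, v⟫_ℂ‖ ^ 2
  have h1 := hR s c
  rw [← hv] at h1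
  have h2 : ‖v‖ ^ 2 ≤ ∑ i ∈ s, ‖c i‖ * ‖⟪e i, v⟫_ℂ‖ := by
    have : ((‖v‖ ^ 2 : ℝ) : ℂ) = ∑ i ∈ s, (starRingEnd ℂ) (c i) * ⟪e i, v⟫_ℂ := by
      have h := inner_self_eq_norm_sq_to_K (𝕜 := ℂ) v
      push_cast
      refine h.symm.trans ?_
      conv_lhs => rw [hv, sum_inner]
      simp only [inner_smul_left, ← hv]
    calc ‖v‖ ^ 2 = ‖((‖v‖ ^ 2 : ℝ) : ℂ)‖ := by
          rw [Complex.norm_real, Real.norm_of_nonneg (by positivity)]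
      _ ≤ _ := by
          rw [this]
          refine (norm_sum_le _ _).trans_eq (Finset.sum_congr rfl fun i _ => ?_)
          rw [norm_mul, RCLike.norm_conj]
  have h3 := Finset.sum_mul_sq_le_sq_mul_sq s (fun i => ‖c i‖) fun i => ‖⟪e i, v⟫_ℂ‖
  have h4 : ∑ i ∈ s, ‖⟪e i, v⟫_ℂ‖ ^ 2 ≤ ∑' i, ‖⟪e i, v⟫_ℂ‖ ^ 2 :=
    (hB v).1.sum_le_tsum s fun i _ => by positivity
  have h5 : (‖v‖ ^ 2) ^ 2 ≤ (∑ i ∈ s, ‖c i‖ * ‖⟪e i, v⟫_ℂ‖) ^ 2 :=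
    pow_le_pow_left₀ (by positivity) h2 2
  rcases (sq_nonneg ‖v‖).eq_or_lt with h | h
  · rw [← h, mul_zero]
    exact tsum_nonneg fun i => by positivity
  · refine le_of_mul_le_mul_left ?_ h
    calc ‖v‖ ^ 2 * (A * ‖v‖ ^ 2) = A * (‖v‖ ^ 2) ^ 2 := by ring
      _ ≤ A * ((∑ i ∈ s, ‖c i‖ ^ 2) * ∑' i, ‖⟪e i, v⟫_ℂ‖ ^ 2) := by
          gcongr
          exact h5.trans (h3.trans (by gcongr))
      _ = (A * ∑ i ∈ s, ‖c i‖ ^ 2) * ∑' i, ‖⟪e i, v⟫_ℂ‖ ^ 2 := by ring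
      _ ≤ _ := mul_le_mul_of_nonneg_right h1 (tsum_nonneg fun i => by positivity)

/-- The lower Riesz inequality makes the coefficients of a convergent expansion unique; here for the
expansion of `e j` itself. -/
theorem coeff_eq_one_of_riesz {A : ℝ} (hA : 0 < A)
    (hR : ∀ (s : Finset ι) (c : ι → ℂ), A * ∑ i ∈ s, ‖c i‖ ^ 2 ≤ ‖∑ i ∈ s, c i • e i‖ ^ 2)
    {c : ι → ℂ} {j : ι} (hc : HasSum (fun i => c i • e i) (e j)) : c j = 1 := by
  classical
  have hev : ∀ᶠ s in atTop, A * ‖c j - 1‖ ^ 2 ≤ ‖∑ i ∈ s, c i • e i - e j‖ ^ 2 := by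
    filter_upwards [eventually_ge_atTop {j}] with s hs
    have hj : j ∈ s := hs (Finset.mem_singleton_self j)
    have h := hR s fun i => c i - Pi.single (M := fun _ => ℂ) j 1 i
    have h1 : ∑ i ∈ s, (c i - Pi.single (M := fun _ => ℂ) j 1 i) • e i =
        ∑ i ∈ s, c i • e i - e j := by
      simp only [sub_smul, Finset.sum_sub_distrib]
      congr 1
      rw [Finset.sum_eq_single_of_mem j hj fun i _ hi => by simp [Pi.single_eq_of_ne hi]]
      simp
    rw [h1] at h
    refine le_trans ?_ h
    gcongr
    have := Finset.single_le_sum (f := fun i => ‖c i - Pi.single (M := fun _ => ℂ) j 1 i‖ ^ 2)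
      (fun i _ => by positivity) hj
    simpa using this
  have hlim : Tendsto (fun s : Finset ι => ‖∑ i ∈ s, c i • e i - e j‖ ^ 2) atTop (𝓝 0) := by
    have h := (((hc : Tendsto _ _ _).sub_const (e j)).norm).pow 2
    simpa using h
  have h := ge_of_tendsto hlim hev
  have h2 : ‖c j - 1‖ ^ 2 = 0 :=
    le_antisymm (nonpos_of_mul_nonpos_right h hA) (by positivity)
  exact sub_eq_zero.mp (by simpa using h2)

/-- The orthonormalisation of a Riesz sequence that is an orbit of isometries: it is the orbit of a
unit vector and satisfies Bessel's inequality with bound one. -/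
theorem exists_orthonormal_window [CompleteSpace H] {U : ι → H →L[ℂ] H} {f : H} (i₀ : ι)
    (hf : ∃ c : ℂ, ‖c‖ = 1 ∧ f = c • U i₀ f)
    (hU : ∀ i x y, ⟪U i x, U i y⟫_ℂ = ⟪x, y⟫_ℂ)
    (hperm : ∀ j, ∃ (p : Equiv.Perm ι) (c : ι → ℂ), ∀ i, ‖c i‖ = 1 ∧
      U j (U i f) = c i • U (p i) f)
    {A B : ℝ} (hA : 0 < A) (hB : 0 < B)
    (hR : ∀ c : ι →₀ ℂ,
      A * c.sum (fun _ x => ‖x‖ ^ 2) ≤ ‖c.sum fun i x => x • U i f‖ ^ 2 ∧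
      ‖c.sum fun i x => x • U i f‖ ^ 2 ≤ B * c.sum (fun _ x => ‖x‖ ^ 2)) :
    ∃ h : H, ‖h‖ = 1 ∧ ∀ x, Summable (fun i => ‖⟪U i h, x⟫_ℂ‖ ^ 2) ∧
      ∑' i, ‖⟪U i h, x⟫_ℂ‖ ^ 2 ≤ ‖x‖ ^ 2 := by
  -- On the closed span `K` the family is a frame; its canonical Parseval frame is orthonormal.
  have hlow := fun s c => (riesz_finset hR s c).1
  have hbes := bessel_of_riesz hB.le fun s c => (riesz_finset hR s c).2
  have hlow' := fun x => lower_frame_of_riesz hA hlow hbes (f := x)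
  set K := (Submodule.span ℂ (range fun i => U i f)).topologicalClosure with hK
  have hmem : ∀ i, U i f ∈ K := fun i =>
    Submodule.le_topologicalClosure _ (Submodule.subset_span ⟨i, rfl⟩)
  have hinv : ∀ j, ∀ x ∈ K, U j x ∈ K := fun j => by
    have hcl : IsClosed (K.comap (U j : H →ₗ[ℂ] H) : Set H) :=
      (Submodule.isClosed_topologicalClosure _).preimage (U j).continuous
    refine Submodule.topologicalClosure_minimal _ (Submodule.span_le.mpr ?_) hcl
    rintro _ ⟨i, rfl⟩
    obtain ⟨p, c, hc⟩ := hperm j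
    change U j (U i f) ∈ K
    rw [(hc i).2]
    exact K.smul_mem _ (hmem _)
  have : CompleteSpace K := (Submodule.isClosed_topologicalClosure _).completeSpace_coe
  have : Nonempty ι := ⟨i₀⟩
  let V : ι → K →L[ℂ] K := fun i => (U i).restrict (hinv i)
  obtain ⟨c, hc1, hcf⟩ := hf
  let g : K := ⟨f, by rw [hcf]; exact K.smul_mem c (hmem i₀)⟩
  obtain ⟨S, R, hS, hsym, hSRR, hpars, -⟩ := exists_parseval_window (U := V) (f := g) (A := A)
    (B := B) (fun i x y => hU i x y)
    (fun j => by
      obtain ⟨p, c, hc⟩ := hperm j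
      exact ⟨p, c, fun i => ⟨(hc i).1, Subtype.ext (hc i).2⟩⟩)
    hA (fun x => ⟨(hbes x).1, hlow' x x.2, (hbes x).2⟩)
  have hVg : g = c • V i₀ g := Subtype.ext hcf
  refine ⟨R g, ?_, fun x => ?_⟩
  · -- `V i₀ g = S (R (R (V i₀ g)))` expands `V i₀ g` in the Riesz sequence, so the `i₀`-th
    -- coefficient, which is `‖R (V i₀ g)‖ ^ 2`, equals `1`.
    have h1 := hS (R (R (V i₀ g)))
    rw [hSRR] at h1
    have h2 := coeff_eq_one_of_riesz (e := fun i => V i g) hA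
      (fun s c => by simpa [V, g] using hlow s c) h1
    rw [← hsym, inner_self_eq_norm_sq_to_K] at h2
    have h3 : ‖R (V i₀ g)‖ ^ 2 = 1 := by exact_mod_cast (congrArg Complex.re h2)
    rw [pow_eq_one_iff_of_nonneg (norm_nonneg _) two_ne_zero] at h3
    have h4 : ‖R g‖ = ‖R (V i₀ g)‖ := by
      conv_lhs => rw [hVg, map_smul, norm_smul, hc1, one_mul]
    exact h4.trans h3
  · have h := hpars (K.orthogonalProjectionOnto x)
    have h1 : ∀ i, ⟪V i (R g), K.orthogonalProjectionOnto x⟫_ℂ = ⟪U i (R g), x⟫_ℂ := fun i =>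
      Submodule.inner_orthogonalProjectionOnto_eq_of_mem_left _ _
    simp only [h1] at h
    refine ⟨h.summable, h.tsum_eq.trans_le ?_⟩
    gcongr
    exact K.norm_orthogonalProjectionOnto_apply_le x

end HilbertFrames

/-! ### The Fourier transform on `L¹ ∩ L²` -/

section FourierIntegral

open scoped ContDiff

theorem continuous_fourierInv {g : ℝ → ℂ} (hg : Integrable g) : Continuous (𝓕⁻ g) :=
  VectorFourier.fourierIntegral_continuous (L := -innerₗ ℝ) Real.continuous_fourierChar
    (by simpa using! continuous_inner.neg) hg

theorem integral_fourierInv_smul_eq {φ g : ℝ → ℂ} (hφ : Integrable φ) (hg : Integrable g) :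
    ∫ ξ, 𝓕⁻ φ ξ • g ξ = ∫ x, φ x • 𝓕⁻ g x := by
  have hL : Continuous fun p : ℝ × ℝ => (-innerₗ ℝ : ℝ →ₗ[ℝ] ℝ →ₗ[ℝ] ℝ) p.1 p.2 := by
    change Continuous fun p : ℝ × ℝ => -(inner ℝ p.1 p.2)
    fun_prop
  have h := VectorFourier.integral_fourierIntegral_smul_eq_flip (L := -innerₗ ℝ)
    Real.continuous_fourierChar hL hφ hg
  have hflip : (-innerₗ ℝ : ℝ →ₗ[ℝ] ℝ →ₗ[ℝ] ℝ).flip = -innerₗ ℝ := by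
    ext; simp
  rw [hflip] at h
  exact h

/-- On `L¹ ∩ L²` the `L²` inverse Fourier transform is given by the inverse Fourier integral. -/
theorem coeFn_fourierInv_toLp {g : ℝ → ℂ} (hg1 : Integrable g) (hg2 : MemLp g 2) :
    (𝓕⁻ (hg2.toLp g) : Lp ℂ 2 (volume : Measure ℝ)) =ᵐ[volume] 𝓕⁻ g := by
  refine ae_eq_of_integral_contDiff_smul_eq ((Lp.memLp _).locallyIntegrable (by norm_num))
    (continuous_fourierInv hg1).locallyIntegrable fun φ hφ hφc => ?_
  have h₁ : HasCompactSupport (Complex.ofRealCLM ∘ φ) := hφc.comp_left rfl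
  have h₂ : ContDiff ℝ ∞ (Complex.ofRealCLM ∘ φ) := by fun_prop
  set Φ := h₁.toSchwartzMap h₂ with hΦ
  have h := congrArg (fun T : TemperedDistribution ℝ ℂ => T Φ)
    (Lp.fourierInv_toTemperedDistribution_eq (hg2.toLp g))
  simp only [TemperedDistribution.fourierInv_apply, Lp.toTemperedDistribution_apply] at h
  have h3 : ∫ x, (𝓕⁻ Φ) x • (hg2.toLp g) x = ∫ x, 𝓕⁻ (Φ : ℝ → ℂ) x • g x := by
    refine integral_congr_ae ?_
    filter_upwards [hg2.coeFn_toLp] with x hx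
    rw [hx, SchwartzMap.fourierInv_coe]
  rw [h3, integral_fourierInv_smul_eq Φ.integrable hg1] at h
  have h4 : ∀ x, Φ x = (φ x : ℂ) := fun x => rfl
  simp only [h4] at h
  simpa [Complex.real_smul] using h.symm

/-- Plancherel's theorem on `L¹ ∩ L²`. -/
theorem lintegral_enorm_sq_fourierInv {g : ℝ → ℂ} (hg1 : Integrable g) (hg2 : MemLp g 2) :
    ∫⁻ x, ‖𝓕⁻ g x‖ₑ ^ 2 = ∫⁻ ξ, ‖g ξ‖ₑ ^ 2 := by
  have key : ∀ f : ℝ → ℂ, ∫⁻ x, ‖f x‖ₑ ^ 2 = eLpNorm f 2 volume ^ 2 := fun f => by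
    rw [eLpNorm_eq_lintegral_rpow_enorm_toReal (by norm_num) (by norm_num), ← ENNReal.rpow_natCast,
      ← ENNReal.rpow_mul]
    norm_num
  have h : ‖(𝓕⁻ (hg2.toLp g) : Lp ℂ 2 (volume : Measure ℝ))‖ₑ = ‖hg2.toLp g‖ₑ := by
    rw [← ofReal_norm, ← ofReal_norm]
    exact congrArg _ ((Lp.fourierTransformₗᵢ ℝ ℂ).symm.norm_map _)
  rw [key, key, ← eLpNorm_congr_ae (coeFn_fourierInv_toLp hg1 hg2), ← Lp.enorm_def, h,
    Lp.enorm_toLp]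

/-- Injectivity of the Fourier integral on `L¹ ∩ L²`. -/
theorem ae_eq_zero_of_fourierInv_eq_zero {g : ℝ → ℂ} (hg1 : Integrable g) (hg2 : MemLp g 2)
    (h : ∀ x, 𝓕⁻ g x = 0) : g =ᵐ[volume] 0 := by
  have h1 := lintegral_enorm_sq_fourierInv hg1 hg2
  simp only [h, enorm_zero, ne_eq, OfNat.ofNat_ne_zero, not_false_eq_true, zero_pow,
    lintegral_zero] at h1
  rw [eq_comm, lintegral_eq_zero_iff' (hg1.1.enorm.pow_const 2)] at h1
  filter_upwards [h1] with x hx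
  simpa using hx

end FourierIntegral

/-! ### Laguerre polynomials -/

section Laguerre

open Polynomial

/-- The polynomial `ω ↦ L_n^α(2ω)`. -/
def laguerrePoly (n : ℕ) (α : ℝ) : ℝ[X] :=
  ∑ k ∈ Finset.range (n + 1),
    C ((-1) ^ k * (Real.Gamma (n + α + 1) / (Real.Gamma (k + α + 1) * (n - k).factorial)) *
      (2 ^ k / k.factorial)) * X ^ k

theorem eval_laguerrePoly (n : ℕ) (α ω : ℝ) :
    (laguerrePoly n α).eval ω = laguerre n α (2 * ω) := by
  rw [laguerrePoly, laguerre, eval_finsetSum]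
  refine Finset.sum_congr rfl fun k _ => ?_
  rw [eval_mul, eval_C, eval_pow, eval_X, mul_pow]
  ring

theorem laguerrePoly_ne_zero (n : ℕ) {α : ℝ} (hα : 0 < α) : laguerrePoly n α ≠ 0 := by
  intro h
  have h0 : (laguerrePoly n α).coeff 0 = 0 := by rw [h, coeff_zero]
  rw [coeff_zero_eq_eval_zero, eval_laguerrePoly, laguerre,
    Finset.sum_eq_single_of_mem 0 (by simp) (by intro k _ hk; simp [hk])] at h0
  have h1 : 0 < Real.Gamma (n + α + 1) := Real.Gamma_pos_of_pos (by positivity)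
  have h2 : 0 < Real.Gamma ((0 : ℕ) + α + 1) := Real.Gamma_pos_of_pos (by positivity)
  have h3 : 0 < (n - 0).factorial := Nat.factorial_pos _
  have : 0 < (-1) ^ 0 * (Real.Gamma (n + α + 1) / (Real.Gamma ((0 : ℕ) + α + 1) *
      (n - 0).factorial)) * ((2 * 0) ^ 0 / (Nat.factorial 0 : ℝ)) := by
    simp only [pow_zero, Nat.factorial_zero]
    positivity
  exact this.ne' h0

theorem natDegree_laguerrePoly_le (n : ℕ) (α : ℝ) : (laguerrePoly n α).natDegree ≤ n := by
  refine natDegree_sum_le_of_forall_le _ _ fun k hk => ?_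
  refine (natDegree_C_mul_X_pow_le _ _).trans ?_
  simpa [Nat.lt_succ_iff] using hk

theorem integrableOn_rpow_mul_exp {β : ℝ} (hβ : -1 < β) :
    IntegrableOn (fun ω : ℝ => ω ^ β * Real.exp (-2 * ω)) (Ioi 0) := by
  simpa using integrableOn_rpow_mul_exp_neg_mul_rpow (s := β) (p := 1) (b := 2) hβ one_pos
    (by norm_num)

theorem integral_rpow_mul_exp {β : ℝ} (hβ : -1 < β) :
    ∫ ω in Ioi (0 : ℝ), ω ^ β * Real.exp (-2 * ω) = Real.Gamma (β + 1) / 2 ^ (β + 1) := by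
  have h := integral_rpow_mul_exp_neg_mul_rpow (p := 1) (q := β) (b := 2) one_pos hβ (by norm_num)
  simp only [Real.rpow_one, div_one, mul_one] at h
  rw [h, Real.rpow_neg (by norm_num)]
  ring

theorem rpow_mul_exp_mul_pow {β ω : ℝ} (k : ℕ) (hω : ω ∈ Ioi (0 : ℝ)) :
    ω ^ β * Real.exp (-2 * ω) * ω ^ k = ω ^ (β + k) * Real.exp (-2 * ω) := by
  rw [Real.rpow_add hω, Real.rpow_natCast]
  ring

theorem integrableOn_rpow_mul_exp_mul_eval {β : ℝ} (hβ : -1 < β) (P : ℝ[X]) :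
    IntegrableOn (fun ω : ℝ => ω ^ β * Real.exp (-2 * ω) * P.eval ω) (Ioi 0) := by
  induction P using Polynomial.induction_on' with
  | add p q hp hq =>
    simp only [eval_add, mul_add]
    exact hp.add hq
  | monomial k c =>
    have h : -1 < β + k := by have : (0 : ℝ) ≤ k := k.cast_nonneg; linarith
    refine IntegrableOn.congr_fun (Integrable.const_mul (integrableOn_rpow_mul_exp h) c)
      (fun ω hω => ?_) measurableSet_Ioi
    simp only [← rpow_mul_exp_mul_pow k hω, eval_monomial]
    ring

theorem integral_rpow_mul_exp_mul_monomial {β : ℝ} (hβ : -1 < β) (k : ℕ) (c : ℝ) :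
    ∫ ω in Ioi (0 : ℝ), ω ^ β * Real.exp (-2 * ω) * (monomial k c).eval ω =
      c * (Real.Gamma (β + k + 1) / 2 ^ (β + k + 1)) := by
  have h : -1 < β + k := by have : (0 : ℝ) ≤ k := k.cast_nonneg; linarith
  rw [← integral_rpow_mul_exp h, ← integral_const_mul]
  refine setIntegral_congr_fun measurableSet_Ioi fun ω hω => ?_
  simp only [← rpow_mul_exp_mul_pow k hω, eval_monomial]
  ring

/-- Integration by parts against the weight `ω^α e^(-2ω)`. -/
theorem integral_weight_by_parts {α : ℝ} (hα : 0 < α) (P : ℝ[X]) :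
    α * ∫ ω in Ioi (0 : ℝ), ω ^ (α - 1) * Real.exp (-2 * ω) * P.eval ω =
      ∫ ω in Ioi (0 : ℝ), ω ^ α * Real.exp (-2 * ω) * (2 * P - derivative P).eval ω := by
  have h1 : -1 < α - 1 := by linarith
  have h2 : -1 < α := by linarith
  induction P using Polynomial.induction_on' with
  | add p q hp hq =>
    have e : 2 * (p + q) - derivative (p + q) =
        (2 * p - derivative p) + (2 * q - derivative q) := by
      rw [derivative_add]; ring
    rw [e]
    simp only [eval_add, mul_add] at hp hq ⊢
    rw [integral_add (integrableOn_rpow_mul_exp_mul_eval h1 p)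
      (integrableOn_rpow_mul_exp_mul_eval h1 q), mul_add, hp, hq, ← integral_add
      (integrableOn_rpow_mul_exp_mul_eval h2 _) (integrableOn_rpow_mul_exp_mul_eval h2 _)]
  | monomial k c =>
    have e : 2 * monomial k c - derivative (monomial k c) =
        monomial k (2 * c) - monomial (k - 1) (c * k) := by
      rw [derivative_monomial, ← C_ofNat, C_mul_monomial]
    rw [e, integral_rpow_mul_exp_mul_monomial h1]
    simp only [eval_sub, mul_sub]
    rw [integral_sub (integrableOn_rpow_mul_exp_mul_eval h2 _)
      (integrableOn_rpow_mul_exp_mul_eval h2 _), integral_rpow_mul_exp_mul_monomial h2,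
      integral_rpow_mul_exp_mul_monomial h2]
    have hp : (0 : ℝ) < 2 ^ (α + k) := by positivity
    have hk : 0 < α + k := by positivity
    have e1 : Real.Gamma (α + k + 1) = (α + k) * Real.Gamma (α + k) :=
      Real.Gamma_add_one hk.ne'
    have e2 : (2 : ℝ) ^ (α + k + 1) = 2 ^ (α + k) * 2 := by
      rw [Real.rpow_add_one (by norm_num)]
    rw [show α - 1 + k + 1 = α + k by ring, e1, e2]
    rcases k with _ | k
    · simp
      field_simp
    · rw [show α + ((k + 1 - 1 : ℕ) : ℝ) + 1 = α + (k + 1 : ℕ) by push_cast; ring]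
      field_simp
      ring

theorem Gamma_add_natCast_eq_ascPochhammer {x : ℝ} (hx : 0 < x) (j : ℕ) :
    Real.Gamma (x + j) = Real.Gamma x * (ascPochhammer ℝ j).eval x := by
  induction j with
  | zero => simp
  | succ j ih =>
    rw [ascPochhammer_succ_eval, ← mul_assoc, ← ih, Nat.cast_succ, ← add_assoc,
      Real.Gamma_add_one (by positivity), mul_comm]

/-- The Laguerre polynomials are orthogonal to all monomials of lower degree; this is the vanishing
of the `n`-th difference of a polynomial of lower degree. -/
theorem integral_laguerrePoly_mul_pow {n j : ℕ} (hj : j < n) {α : ℝ} (hα : 0 < α) :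
    ∫ ω in Ioi (0 : ℝ), ω ^ α * Real.exp (-2 * ω) * (laguerrePoly n α * X ^ j).eval ω = 0 := by
  have h2 : -1 < α := by linarith
  set P : ℝ[X] := (ascPochhammer ℝ j).comp (X + C (α + 1)) with hP
  have hdeg : P.natDegree < n := by
    rw [hP, natDegree_comp, ascPochhammer_natDegree, natDegree_X_add_C]
    simpa using hj
  have hdiff := congrFun (Polynomial.fwdDiff_iter_eq_zero_of_degree_lt hdeg) 0
  rw [fwdDiff_iter_eq_sum_shift] at hdiff
  have hΓ : ∀ k : ℕ, Real.Gamma (α + (k + j : ℕ) + 1) = Real.Gamma (k + α + 1) * P.eval (k : ℝ) :=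
    fun k => by
      rw [hP, eval_comp, eval_add, eval_X, eval_C, ← add_assoc,
        ← Gamma_add_natCast_eq_ascPochhammer (by positivity)]
      congr 1; push_cast; ring
  have e : laguerrePoly n α * X ^ j = ∑ k ∈ Finset.range (n + 1), monomial (k + j)
      ((-1) ^ k * (Real.Gamma (n + α + 1) / (Real.Gamma (k + α + 1) * (n - k).factorial)) *
        (2 ^ k / k.factorial)) := by
    rw [laguerrePoly, Finset.sum_mul]
    refine Finset.sum_congr rfl fun k _ => ?_
    rw [mul_assoc, ← pow_add, C_mul_X_pow_eq_monomial]
  simp only [e, eval_finsetSum, Finset.mul_sum]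
  rw [integral_finsetSum _ fun k _ => integrableOn_rpow_mul_exp_mul_eval h2 _]
  simp only [integral_rpow_mul_exp_mul_monomial h2, hΓ]
  have hs : ∀ k ∈ Finset.range (n + 1),
      (-1) ^ k * (Real.Gamma (n + α + 1) / (Real.Gamma (k + α + 1) * (n - k).factorial)) *
        (2 ^ k / k.factorial) *
        (Real.Gamma (k + α + 1) * P.eval (k : ℝ) / 2 ^ (α + (k + j : ℕ) + 1)) =
      ((-1) ^ n * Real.Gamma (n + α + 1) / (n.factorial * 2 ^ (α + j + 1))) *
        (((-1 : ℤ) ^ (n - k) * n.choose k) • P.eval (0 + k • (1 : ℝ))) := fun k hk => by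
    have hkn : k ≤ n := by simpa [Nat.lt_succ_iff] using hk
    have hG := (Real.Gamma_pos_of_pos (show 0 < k + α + 1 by positivity)).ne'
    have e1 : (2 : ℝ) ^ (α + (k + j : ℕ) + 1) = 2 ^ (α + j + 1) * 2 ^ k := by
      rw [← Real.rpow_natCast, ← Real.rpow_add (by norm_num)]
      congr 1; push_cast; ring
    have e2 : ((-1 : ℝ)) ^ n = (-1) ^ (n - k) * (-1) ^ k := by
      rw [← pow_add, Nat.sub_add_cancel hkn]
    have e3 : ((-1 : ℝ) ^ (n - k)) * (-1) ^ (n - k) = 1 := by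
      rw [← mul_pow]; norm_num
    have e4 : (n.choose k : ℝ) = n.factorial / (k.factorial * (n - k).factorial) :=
      Nat.cast_choose ℝ hkn
    rw [e1, e2, zsmul_eq_mul, nsmul_eq_mul, mul_one, zero_add]
    push_cast
    rw [e4]
    have := n.factorial_ne_zero
    have := k.factorial_ne_zero
    have := (n - k).factorial_ne_zero
    field_simp
    linear_combination (- (eval (k : ℝ) P)) * e3
  rw [Finset.sum_congr rfl hs, ← Finset.mul_sum]
  refine mul_eq_zero_of_right _ hdiff

theorem integral_laguerrePoly_mul {n : ℕ} {α : ℝ} (hα : 0 < α) {Q : ℝ[X]} (hQ : Q.degree < n) :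
    ∫ ω in Ioi (0 : ℝ), ω ^ α * Real.exp (-2 * ω) * (laguerrePoly n α * Q).eval ω = 0 := by
  have h2 : -1 < α := by linarith
  have e : laguerrePoly n α * Q =
      ∑ j ∈ Q.support, C (Q.coeff j) * (laguerrePoly n α * X ^ j) := by
    conv_lhs => rw [Q.as_sum_support_C_mul_X_pow, Finset.mul_sum]
    exact Finset.sum_congr rfl fun j _ => by ring
  simp only [e, eval_finsetSum, Finset.mul_sum]
  rw [integral_finsetSum _ fun k _ => integrableOn_rpow_mul_exp_mul_eval h2 _]
  refine Finset.sum_eq_zero fun j hj => ?_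
  have hjn : j < n := by
    exact_mod_cast (le_degree_of_mem_supp j hj).trans_lt hQ
  have := integral_laguerrePoly_mul_pow hjn hα
  simp only [eval_mul, eval_C] at this ⊢
  simp only [mul_left_comm _ (Q.coeff j)]
  rw [integral_const_mul, this, mul_zero]

/-- The computation behind `C_ψ / ‖ψ‖² = 2 / α`: the boundary-free integration by parts for
`ω^α e^(-2ω) L(2ω)²`, in which the term with the derivative of `L` drops out by orthogonality. -/
theorem integral_laguerrePoly_sq (n : ℕ) {α : ℝ} (hα : 0 < α) :
    α * ∫ ω in Ioi (0 : ℝ), ω ^ (α - 1) * Real.exp (-2 * ω) * (laguerrePoly n α ^ 2).eval ω =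
      2 * ∫ ω in Ioi (0 : ℝ), ω ^ α * Real.exp (-2 * ω) * (laguerrePoly n α ^ 2).eval ω := by
  have h2 : -1 < α := by linarith
  have h0 : ∫ ω in Ioi (0 : ℝ), ω ^ α * Real.exp (-2 * ω) *
      (laguerrePoly n α * (2 * derivative (laguerrePoly n α))).eval ω = 0 := by
    refine integral_laguerrePoly_mul hα ?_
    rw [← C_ofNat, degree_C_mul (by norm_num)]
    exact (degree_derivative_lt (laguerrePoly_ne_zero n hα)).trans_le
      (natDegree_le_iff_degree_le.mp (natDegree_laguerrePoly_le n α))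
  have e : 2 * laguerrePoly n α ^ 2 - derivative (laguerrePoly n α ^ 2) =
      C 2 * laguerrePoly n α ^ 2 - laguerrePoly n α * (2 * derivative (laguerrePoly n α)) := by
    rw [derivative_sq]
    simp only [C_ofNat]
    ring
  rw [integral_weight_by_parts hα, e]
  simp only [eval_sub, mul_sub]
  rw [integral_sub (integrableOn_rpow_mul_exp_mul_eval h2 _)
    (integrableOn_rpow_mul_exp_mul_eval h2 _), h0, sub_zero, ← integral_const_mul]
  refine setIntegral_congr_fun measurableSet_Ioi fun ω hω => ?_
  simp only [eval_mul, eval_C]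
  ring

theorem integral_laguerrePoly_sq_pos (n : ℕ) {α : ℝ} (hα : 0 < α) :
    0 < ∫ ω in Ioi (0 : ℝ), ω ^ α * Real.exp (-2 * ω) * (laguerrePoly n α ^ 2).eval ω := by
  have h2 : -1 < α := by linarith
  rw [setIntegral_pos_iff_support_of_nonneg_ae]
  · have hfin : volume ((laguerrePoly n α).rootSet ℝ) = 0 :=
      (Set.Finite.measure_zero (rootSet_finite _ _) _)
    have hsub : Ioi (0 : ℝ) \ (laguerrePoly n α).rootSet ℝ ⊆
        Function.support (fun ω : ℝ => ω ^ α * Real.exp (-2 * ω) *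
          (laguerrePoly n α ^ 2).eval ω) ∩ Ioi 0 := fun ω hω => by
      refine ⟨?_, hω.1⟩
      have hω0 : (0 : ℝ) < ω := hω.1
      have hr : (laguerrePoly n α).eval ω ≠ 0 := fun h => hω.2 <| by
        rw [mem_rootSet]
        exact ⟨laguerrePoly_ne_zero n hα, by simpa using h⟩
      simp only [Function.mem_support, eval_pow]
      positivity
    refine lt_of_lt_of_le ?_ (measure_mono hsub)
    rw [measure_sdiff_null hfin, Real.volume_Ioi]
    exact ENNReal.zero_lt_top
  · filter_upwards [ae_restrict_mem measurableSet_Ioi] with ω hω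
    have hω0 : (0 : ℝ) < ω := hω
    simp only [eval_pow, Pi.zero_apply]
    positivity
  · exact integrableOn_rpow_mul_exp_mul_eval h2 _

end Laguerre

/-! ### The window and its norms -/

section Window

theorem norm_toLp_sq {X : Type*} [MeasurableSpace X] {μ : Measure X} {f : X → ℂ}
    (hf : MemLp f 2 μ) : ‖hf.toLp f‖ ^ 2 = ∫ x, ‖f x‖ ^ 2 ∂μ := by
  have h := inner_self_eq_norm_sq_to_K (𝕜 := ℂ) (hf.toLp f)
  rw [L2.inner_def] at h
  have e : ∫ x, inner ℂ (hf.toLp f x) (hf.toLp f x) ∂μ = ((∫ x, ‖f x‖ ^ 2 ∂μ : ℝ) : ℂ) := by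
    rw [← integral_complex_ofReal]
    refine integral_congr_ae ?_
    filter_upwards [hf.coeFn_toLp] with x hx
    rw [hx, inner_self_eq_norm_sq_to_K]
    norm_cast
  rw [e] at h
  have h2 := congrArg Complex.re h
  norm_cast at h2
  exact h2.symm

open Polynomial in
theorem exists_bound_rpow_mul_exp_mul_eval {s : ℝ} (hs : 0 ≤ s) (P : ℝ[X]) :
    ∃ M, ∀ ω, 0 < ω → |ω ^ s * Real.exp (-ω) * P.eval ω| ≤ M * Real.exp (-(ω / 2)) := by
  induction P using Polynomial.induction_on' with
  | add p q hp hq =>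
    obtain ⟨M, hM⟩ := hp
    obtain ⟨M', hM'⟩ := hq
    refine ⟨M + M', fun ω hω => ?_⟩
    rw [eval_add, mul_add, add_mul]
    exact (abs_add_le _ _).trans (add_le_add (hM ω hω) (hM' ω hω))
  | monomial k c =>
    obtain ⟨m, hm⟩ := exists_nat_ge (s + k)
    refine ⟨(1 + m.factorial * 2 ^ m) * |c|, fun ω hω => ?_⟩
    have h1 : ω ^ (s + k) ≤ (1 + m.factorial * 2 ^ m) * Real.exp (ω / 2) := by
      have he : 1 ≤ Real.exp (ω / 2) := Real.one_le_exp (by positivity)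
      have hf : (0 : ℝ) < m.factorial := by exact_mod_cast m.factorial_pos
      rcases le_total ω 1 with h | h
      · have := Real.rpow_le_one hω.le h (show 0 ≤ s + k by positivity)
        have h2 : (0 : ℝ) ≤ m.factorial * 2 ^ m := by positivity
        nlinarith
      · have h3 := Real.rpow_le_rpow_of_exponent_le h hm
        rw [Real.rpow_natCast] at h3
        have h4 := Real.pow_div_factorial_le_exp (ω / 2) (by positivity) m
        rw [div_pow, div_div, div_le_iff₀ (by positivity)] at h4
        nlinarith
    rw [eval_monomial, abs_mul, abs_mul, abs_mul, abs_of_pos (Real.exp_pos _),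
      abs_of_pos (Real.rpow_pos_of_pos hω s), abs_of_pos (pow_pos hω k)]
    have e : Real.exp (-ω) = Real.exp (-(ω / 2)) * Real.exp (-(ω / 2)) := by
      rw [← Real.exp_add]; ring_nf
    have e1 : Real.exp (ω / 2) * Real.exp (-(ω / 2)) = 1 := by rw [← Real.exp_add]; simp
    calc ω ^ s * Real.exp (-ω) * (|c| * ω ^ k)
        = ω ^ (s + k) * (Real.exp (-(ω / 2)) * Real.exp (-(ω / 2)) * |c|) := by
          rw [e, Real.rpow_add hω, Real.rpow_natCast]; ring
      _ ≤ (1 + m.factorial * 2 ^ m) * Real.exp (ω / 2) *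
          (Real.exp (-(ω / 2)) * Real.exp (-(ω / 2)) * |c|) := by gcongr
      _ = (Real.exp (ω / 2) * Real.exp (-(ω / 2))) *
          ((1 + m.factorial * 2 ^ m) * |c| * Real.exp (-(ω / 2))) := by ring
      _ = _ := by rw [e1, one_mul]

variable (n : ℕ) (α : ℝ)

theorem psiHat_of_pos {ω : ℝ} (hω : 0 < ω) :
    psiHat n α ω = ((ω ^ (α / 2) * Real.exp (-ω) * (laguerrePoly n α).eval ω : ℝ) : ℂ) := by
  rw [psiHat, indicator_of_mem (mem_Ioi.mpr hω), eval_laguerrePoly]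

theorem psiHat_of_nonpos {ω : ℝ} (hω : ω ≤ 0) : psiHat n α ω = 0 :=
  indicator_of_notMem (by simpa using hω) _

@[fun_prop]
theorem measurable_psiHat : Measurable (psiHat n α) := by
  unfold psiHat laguerre
  refine Measurable.indicator ?_ measurableSet_Ioi
  fun_prop

theorem exists_bound_psiHat {α : ℝ} (hα : 0 < α) :
    ∃ M, 0 ≤ M ∧ ∀ ω, ‖psiHat n α ω‖ ≤
      (Ioi (0 : ℝ)).indicator (fun ω => M * Real.exp (-(ω / 2))) ω := by
  obtain ⟨M, hM⟩ := exists_bound_rpow_mul_exp_mul_eval (show 0 ≤ α / 2 by positivity)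
    (laguerrePoly n α)
  have hM0 : 0 ≤ M := nonneg_of_mul_nonneg_left ((abs_nonneg _).trans (hM 1 one_pos))
    (Real.exp_pos _)
  refine ⟨M, hM0, fun ω => ?_⟩
  rcases lt_or_ge 0 ω with h | h
  · rw [psiHat_of_pos n α h, Complex.norm_real, indicator_of_mem (mem_Ioi.mpr h)]
    exact hM ω h
  · rw [psiHat_of_nonpos n α h, norm_zero, indicator_of_notMem (by simpa using h)]

theorem exists_norm_psiHat_le {α : ℝ} (hα : 0 < α) : ∃ M, ∀ ω, ‖psiHat n α ω‖ ≤ M := by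
  obtain ⟨M, hM0, hM⟩ := exists_bound_psiHat n hα
  refine ⟨M, fun ω => (hM ω).trans (indicator_le' (fun ω hω => ?_) (fun _ _ => hM0) ω)⟩
  have : Real.exp (-(ω / 2)) ≤ 1 := Real.exp_le_one_iff.mpr (by
    have : (0 : ℝ) < ω := hω
    linarith)
  exact mul_le_of_le_one_right hM0 this

theorem integrable_psiHat {α : ℝ} (hα : 0 < α) : Integrable (psiHat n α) := by
  obtain ⟨M, -, hM⟩ := exists_bound_psiHat n hα
  refine Integrable.mono' ?_ (measurable_psiHat n α).aestronglyMeasurable (ae_of_all _ hM)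
  rw [integrable_indicator_iff measurableSet_Ioi]
  refine Integrable.const_mul ?_ M
  have := integrableOn_exp_mul_Ioi (show -(1 / 2 : ℝ) < 0 by norm_num) 0
  refine this.congr_fun (fun ω _ => ?_) measurableSet_Ioi
  beta_reduce
  rw [show -(1 / 2) * ω = -(ω / 2) by ring]

theorem norm_sq_psiHat_of_pos {ω : ℝ} (hω : 0 < ω) :
    ‖psiHat n α ω‖ ^ 2 = ω ^ α * Real.exp (-2 * ω) * (laguerrePoly n α ^ 2).eval ω := by
  rw [psiHat_of_pos n α hω, Complex.norm_real, Real.norm_eq_abs, sq_abs, mul_pow, mul_pow,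
    ← Real.rpow_natCast (ω ^ _), ← Real.rpow_mul hω.le, ← Real.exp_nat_mul, Polynomial.eval_pow]
  congr 3 <;> push_cast <;> ring

/-- The Fourier transform of the window in the variable of `𝓕`. -/
def windowHat (ξ : ℝ) : ℂ := ((√(2 * Real.pi) : ℝ) : ℂ) * psiHat n α (2 * Real.pi * ξ)

theorem memLp_windowHat {α : ℝ} (hα : 0 < α) : MemLp (windowHat n α) 2 :=
  memLp_psiHat_scaled n hα

theorem integrable_windowHat {α : ℝ} (hα : 0 < α) : Integrable (windowHat n α) :=
  ((integrable_psiHat n hα).comp_mul_left' (by positivity)).const_mul _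

@[fun_prop]
theorem measurable_windowHat : Measurable (windowHat n α) := by
  unfold windowHat; fun_prop

theorem windowHat_of_nonpos {ξ : ℝ} (hξ : ξ ≤ 0) : windowHat n α ξ = 0 := by
  rw [windowHat, psiHat_of_nonpos, mul_zero]
  exact mul_nonpos_of_nonneg_of_nonpos (by positivity) hξ

theorem norm_sq_windowHat (ξ : ℝ) :
    ‖windowHat n α ξ‖ ^ 2 = 2 * Real.pi * ‖psiHat n α (2 * Real.pi * ξ)‖ ^ 2 := by
  rw [windowHat, norm_mul, mul_pow, Complex.norm_real, Real.norm_eq_abs, sq_abs,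
    Real.sq_sqrt (by positivity)]

theorem fourier_psi {α : ℝ} (hα : 0 < α) :
    (𝓕 (psi n α hα) : Lp ℂ 2 (volume : Measure ℝ)) = (memLp_windowHat n hα).toLp _ :=
  FourierTransform.fourier_fourierInv_eq _

theorem quasiMeasurePreserving_div_sub {a : ℝ} (ha : a ≠ 0) (b : ℝ) :
    Measure.QuasiMeasurePreserving (fun t : ℝ => (t - b) / a) volume volume := by
  have h1 : Measure.QuasiMeasurePreserving (fun t : ℝ => a⁻¹ * t) volume volume :=
    ⟨by fun_prop, by
      rw [Real.map_volume_mul_left (inv_ne_zero ha)]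
      exact Measure.smul_absolutelyContinuous⟩
  have h2 := (measurePreserving_sub_right volume b).quasiMeasurePreserving
  have e : (fun t : ℝ => (t - b) / a) = (fun t => a⁻¹ * t) ∘ fun t => t - b := by
    funext t
    rw [Function.comp_apply, div_eq_inv_mul]
  exact e ▸ h1.comp h2

theorem angularFourier_psi {α : ℝ} (hα : 0 < α) :
    angularFourier (psi n α hα) =ᵐ[volume] psiHat n α := by
  have h1 := (quasiMeasurePreserving_div_sub (a := 2 * Real.pi) (by positivity) 0).ae_eq_comp
    (memLp_windowHat n hα).coeFn_toLp
  filter_upwards [h1] with ω hω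
  simp only [Function.comp_apply, sub_zero] at hω
  rw [angularFourier, fourier_psi, hω, windowHat, ← mul_assoc, ← Complex.ofReal_mul,
    inv_mul_cancel₀ (by positivity), mul_div_cancel₀ _ (by positivity)]
  simp

theorem admissibilityConst_psi {α : ℝ} (hα : 0 < α) :
    admissibilityConst (psi n α hα) =
      ∫ ω in Ioi (0 : ℝ), ω ^ (α - 1) * Real.exp (-2 * ω) * (laguerrePoly n α ^ 2).eval ω := by
  refine integral_congr_ae ?_
  filter_upwards [ae_restrict_of_ae (angularFourier_psi n hα),
    ae_restrict_mem measurableSet_Ioi] with ω h hω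
  have hω0 : (0 : ℝ) < ω := hω
  rw [h, norm_sq_psiHat_of_pos n α hω0, Real.rpow_sub_one hω0.ne']
  ring

theorem lintegral_norm_sq_psiHat_div {α : ℝ} (hα : 0 < α) :
    ∫⁻ ω in Ioi (0 : ℝ), ENNReal.ofReal (‖psiHat n α ω‖ ^ 2 / ω) =
      ENNReal.ofReal (admissibilityConst (psi n α hα)) := by
  rw [admissibilityConst_psi, ofReal_integral_eq_lintegral_ofReal
    (integrableOn_rpow_mul_exp_mul_eval (by linarith) _)]
  · refine setLIntegral_congr_fun measurableSet_Ioi fun ω hω => ?_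
    have hω0 : (0 : ℝ) < ω := hω
    simp only [norm_sq_psiHat_of_pos n α hω0, Real.rpow_sub_one hω0.ne']
    congr 1
    ring
  · filter_upwards [ae_restrict_mem measurableSet_Ioi] with ω hω
    have hω0 : (0 : ℝ) < ω := hω
    simp only [Polynomial.eval_pow, Pi.zero_apply]
    positivity

theorem norm_sq_psi {α : ℝ} (hα : 0 < α) :
    ‖psi n α hα‖ ^ 2 =
      ∫ ω in Ioi (0 : ℝ), ω ^ α * Real.exp (-2 * ω) * (laguerrePoly n α ^ 2).eval ω := by
  rw [← Lp.norm_fourier_eq, fourier_psi, norm_toLp_sq]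
  simp only [norm_sq_windowHat]
  rw [integral_const_mul, Measure.integral_comp_mul_left (fun ω => ‖psiHat n α ω‖ ^ 2), smul_eq_mul,
    abs_of_pos (by positivity), ← mul_assoc, mul_inv_cancel₀ (by positivity), one_mul,
    ← setIntegral_eq_integral_of_forall_compl_eq_zero (s := Ioi 0)]
  · exact setIntegral_congr_fun measurableSet_Ioi fun ω hω => norm_sq_psiHat_of_pos n α hω
  · intro ω hω
    rw [psiHat_of_nonpos n α (by simpa using hω)]
    simp

theorem norm_psi_pos {α : ℝ} (hα : 0 < α) : 0 < ‖psi n α hα‖ ^ 2 :=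
  (norm_sq_psi n hα).symm ▸ integral_laguerrePoly_sq_pos n hα

theorem admissibilityConst_div_norm_sq {α : ℝ} (hα : 0 < α) :
    admissibilityConst (psi n α hα) / ‖psi n α hα‖ ^ 2 = 2 / α := by
  rw [div_eq_div_iff (norm_psi_pos n hα).ne' hα.ne', mul_comm, admissibilityConst_psi,
    norm_sq_psi, integral_laguerrePoly_sq n hα]

theorem admissibilityConst_pos {α : ℝ} (hα : 0 < α) : 0 < admissibilityConst (psi n α hα) := by
  have h := admissibilityConst_div_norm_sq n hα
  rw [div_eq_iff (norm_psi_pos n hα).ne'] at h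
  rw [h]
  exact mul_pos (by positivity) (norm_psi_pos n hα)

end Window

/-! ### The wavelet transform on the Fourier side -/

section Kernel

open scoped InnerProductSpace ComplexConjugate

/-- The Hardy space on the Fourier side: `L²(0, ∞)` in the variable of `𝓕`. -/
abbrev FreqSpace : Type := Lp ℂ 2 (volume.restrict (Ioi (0 : ℝ)))

variable (n : ℕ) (α : ℝ)

/-- The Fourier transform of the wavelet `t ↦ y^(-1/2) ψ((t - x) / y)`. -/
def kernelFn (x y ξ : ℝ) : ℂ :=
  ((√y : ℝ) : ℂ) * Complex.exp (((-(2 * Real.pi * x * ξ) : ℝ) : ℂ) * Complex.I) *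
    windowHat n α (y * ξ)

@[fun_prop]
theorem measurable_kernelFn : Measurable fun p : (ℝ × ℝ) × ℝ => kernelFn n α p.1.1 p.1.2 p.2 := by
  unfold kernelFn; fun_prop

theorem measurable_kernelFn_right (x y : ℝ) : Measurable (kernelFn n α x y) := by
  unfold kernelFn; fun_prop

theorem norm_kernelFn (x y ξ : ℝ) : ‖kernelFn n α x y ξ‖ = √y * ‖windowHat n α (y * ξ)‖ := by
  rw [kernelFn, norm_mul, norm_mul, Complex.norm_exp_ofReal_mul_I, mul_one, Complex.norm_real,
    Real.norm_of_nonneg (Real.sqrt_nonneg _)]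

variable {α} in
theorem memLp_kernelFn (hα : 0 < α) (x : ℝ) {y : ℝ} (hy : 0 < y) : MemLp (kernelFn n α x y) 2 := by
  rw [memLp_two_iff_integrable_sq_norm (measurable_kernelFn_right n α x y).aestronglyMeasurable]
  simp only [norm_kernelFn, mul_pow]
  refine Integrable.const_mul ?_ _
  have h := memLp_windowHat n hα
  rw [memLp_two_iff_integrable_sq_norm h.1] at h
  exact h.comp_mul_left' (g := fun ξ => ‖windowHat n α ξ‖ ^ 2) hy.ne'

variable {α} in
theorem integrable_kernelFn (hα : 0 < α) (x : ℝ) {y : ℝ} (hy : 0 < y) :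
    Integrable (kernelFn n α x y) := by
  rw [← integrable_norm_iff (measurable_kernelFn_right n α x y).aestronglyMeasurable]
  simp only [norm_kernelFn]
  exact (((integrable_windowHat n hα).comp_mul_left' hy.ne').norm).const_mul _

variable {α} in
theorem integral_norm_sq_kernelFn (hα : 0 < α) (x : ℝ) {y : ℝ} (hy : 0 < y) :
    ∫ ξ, ‖kernelFn n α x y ξ‖ ^ 2 = ‖psi n α hα‖ ^ 2 := by
  rw [← Lp.norm_fourier_eq, fourier_psi, norm_toLp_sq]
  simp only [norm_kernelFn, mul_pow, Real.sq_sqrt hy.le]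
  rw [integral_const_mul, Measure.integral_comp_mul_left (fun ω => ‖windowHat n α ω‖ ^ 2),
    smul_eq_mul, abs_of_pos (by positivity), ← mul_assoc, mul_inv_cancel₀ (by positivity), one_mul]

theorem kernelFn_of_nonpos (x : ℝ) {y ξ : ℝ} (hy : 0 < y) (hξ : ξ ≤ 0) :
    kernelFn n α x y ξ = 0 := by
  rw [kernelFn, windowHat_of_nonpos _ _ (mul_nonpos_of_nonneg_of_nonpos hy.le hξ), mul_zero]

/-- The inverse Fourier integral turns modulation and dilation into translation and dilation. -/
theorem fourierInv_kernelFn (x : ℝ) {y : ℝ} (hy : 0 < y) (t : ℝ) :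
    𝓕⁻ (kernelFn n α x y) t = ((√y)⁻¹ : ℝ) * 𝓕⁻ (windowHat n α) ((t - x) / y) := by
  have h : ∀ ξ : ℝ, Complex.exp (((2 * Real.pi * inner ℝ ξ t : ℝ) : ℂ) * Complex.I) •
      kernelFn n α x y ξ = ((√y : ℝ) : ℂ) *
        (fun η => Complex.exp (((2 * Real.pi * inner ℝ η ((t - x) / y) : ℝ) : ℂ) * Complex.I) •
          windowHat n α η) (y * ξ) := fun ξ => by
    simp only [kernelFn, smul_eq_mul, RCLike.inner_apply, conj_trivial]
    have e : ((2 * Real.pi * ((t - x) / y * (y * ξ)) : ℝ) : ℂ) =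
        ((2 * Real.pi * (t * ξ) : ℝ) : ℂ) + ((-(2 * Real.pi * x * ξ) : ℝ) : ℂ) := by
      rw [← Complex.ofReal_add]
      congr 1
      field_simp
      ring
    rw [e, add_mul, Complex.exp_add]
    ring
  have key : ∀ G : ℝ → ℂ, ((√y : ℝ) : ℂ) * ∫ ξ, G (y * ξ) = ((√y)⁻¹ : ℝ) * ∫ η, G η := fun G => by
    rw [Measure.integral_comp_mul_left, abs_of_pos (by positivity), Complex.real_smul, ← mul_assoc,
      ← Complex.ofReal_mul]
    congr 2
    field_simp
    rw [Real.sq_sqrt hy.le]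
  rw [Real.fourierInv_eq', Real.fourierInv_eq', integral_congr_ae (ae_of_all _ h),
    integral_const_mul]
  exact key fun η => Complex.exp (((2 * Real.pi * inner ℝ η ((t - x) / y) : ℝ) : ℂ) * Complex.I) •
    windowHat n α η

/-- Parseval's formula for the wavelet transform. -/
theorem waveletTransform_psi {α : ℝ} (hα : 0 < α) (f : Lp ℂ 2 (volume : Measure ℝ)) (z : ℍ) :
    waveletTransform (psi n α hα) f z =
      ⟪(memLp_kernelFn n hα z.re z.im_pos).toLp _, (𝓕 f : Lp ℂ 2 (volume : Measure ℝ))⟫_ℂ := by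
  set K := (memLp_kernelFn n hα z.re z.im_pos).toLp _ with hK
  have h1 : ⟪K, (𝓕 f : Lp ℂ 2 (volume : Measure ℝ))⟫_ℂ =
      ⟪(𝓕⁻ K : Lp ℂ 2 (volume : Measure ℝ)), f⟫_ℂ := by
    rw [← Lp.inner_fourier_eq (𝓕⁻ K) f, FourierTransform.fourier_fourierInv_eq]
  rw [h1, L2.inner_def, waveletTransform]
  refine integral_congr_ae ?_
  have hψ : psi n α hα =ᵐ[volume] 𝓕⁻ (windowHat n α) :=
    coeFn_fourierInv_toLp (integrable_windowHat n hα) (memLp_windowHat n hα)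
  filter_upwards [coeFn_fourierInv_toLp (integrable_kernelFn n hα z.re z.im_pos)
    (memLp_kernelFn n hα z.re z.im_pos),
    (quasiMeasurePreserving_div_sub z.im_pos.ne' z.re).ae_eq_comp hψ] with t ht1 ht2
  simp only [Function.comp_apply] at ht2
  rw [ht1, fourierInv_kernelFn _ _ _ z.im_pos, ht2, RCLike.inner_apply]
  rfl

/-- The wavelet at the point `z`, as an element of the frequency-side Hardy space. -/
def kernelVec {α : ℝ} (hα : 0 < α) (z : ℍ) : FreqSpace :=
  ((memLp_kernelFn n hα z.re z.im_pos).restrict _).toLp _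

/-- The wavelet transform on the frequency side. -/
def freqTransform {α : ℝ} (hα : 0 < α) (φ : FreqSpace) (z : ℍ) : ℂ := ⟪kernelVec n hα z, φ⟫_ℂ

theorem norm_sq_kernelVec {α : ℝ} (hα : 0 < α) (z : ℍ) :
    ‖kernelVec n hα z‖ ^ 2 = ‖psi n α hα‖ ^ 2 := by
  rw [kernelVec, norm_toLp_sq, ← integral_norm_sq_kernelFn n hα z.re z.im_pos,
    setIntegral_eq_integral_of_forall_compl_eq_zero]
  intro ξ hξ
  rw [kernelFn_of_nonpos n α _ z.im_pos (by simpa using hξ)]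
  simp

theorem freqTransform_eq_setIntegral {α : ℝ} (hα : 0 < α) (φ : FreqSpace) (z : ℍ) :
    freqTransform n hα φ z = ∫ ξ in Ioi (0 : ℝ), φ ξ * conj (kernelFn n α z.re z.im ξ) := by
  rw [freqTransform, L2.inner_def]
  refine integral_congr_ae ?_
  filter_upwards [((memLp_kernelFn n hα z.re z.im_pos).restrict (Ioi 0)).coeFn_toLp] with ξ hξ
  rw [kernelVec, hξ, RCLike.inner_apply]

theorem waveletTransform_eq_freqTransform {α : ℝ} (hα : 0 < α) {f : Lp ℂ 2 (volume : Measure ℝ)}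
    {φ : FreqSpace} (h : (𝓕 f : Lp ℂ 2 (volume : Measure ℝ)) =ᵐ[volume.restrict (Ioi 0)] φ) :
    waveletTransform (psi n α hα) f = freqTransform n hα φ := by
  funext z
  rw [waveletTransform_psi, freqTransform_eq_setIntegral, L2.inner_def]
  have h1 : ∫ ξ, ⟪(memLp_kernelFn n hα z.re z.im_pos).toLp _ ξ,
      (𝓕 f : Lp ℂ 2 (volume : Measure ℝ)) ξ⟫_ℂ =
      ∫ ξ, (𝓕 f : Lp ℂ 2 (volume : Measure ℝ)) ξ * conj (kernelFn n α z.re z.im ξ) := by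
    refine integral_congr_ae ?_
    filter_upwards [(memLp_kernelFn n hα z.re z.im_pos).coeFn_toLp] with ξ hξ
    rw [hξ, RCLike.inner_apply]
  rw [h1, ← setIntegral_eq_integral_of_forall_compl_eq_zero (s := Ioi (0 : ℝ))]
  · refine integral_congr_ae ?_
    filter_upwards [h] with ξ hξ
    rw [hξ]
  · intro ξ hξ
    rw [kernelFn_of_nonpos n α _ z.im_pos (by simpa using hξ), map_zero, mul_zero]

/-- Every element of `L²(0, ∞)` is the Fourier transform of an element of the Hardy space, so the
wavelet space is the range of the frequency-side transform. -/
theorem waveletSpace_psi {α : ℝ} (hα : 0 < α) :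
    waveletSpace (psi n α hα) = range (freqTransform n hα) := by
  ext F
  constructor
  · rintro ⟨f, -, rfl⟩
    exact ⟨((Lp.memLp (𝓕 f : Lp ℂ 2 (volume : Measure ℝ))).restrict (Ioi 0)).toLp _,
      (waveletTransform_eq_freqTransform n hα (MemLp.coeFn_toLp _).symm).symm⟩
  · rintro ⟨φ, rfl⟩
    have hφ : MemLp ((Ioi (0 : ℝ)).indicator φ) 2 :=
      (memLp_indicator_iff_restrict measurableSet_Ioi).mpr (Lp.memLp φ)
    have hF : (𝓕 (𝓕⁻ (hφ.toLp _) : Lp ℂ 2 (volume : Measure ℝ)) : Lp ℂ 2 (volume : Measure ℝ))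
        =ᵐ[volume] (Ioi (0 : ℝ)).indicator φ := by
      rw [FourierTransform.fourier_fourierInv_eq]
      exact hφ.coeFn_toLp
    refine ⟨𝓕⁻ (hφ.toLp _), ?_, waveletTransform_eq_freqTransform n hα ?_⟩
    · have h := (quasiMeasurePreserving_div_sub (a := 2 * Real.pi) (by positivity) 0).ae_eq_comp hF
      change ∀ᵐ ω : ℝ, ω < 0 → _
      filter_upwards [h] with ω hω hneg
      simp only [Function.comp_apply, sub_zero] at hω
      rw [angularFourier, hω, indicator_of_notMem, mul_zero]
      rw [mem_Ioi, not_lt]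
      exact div_nonpos_of_nonpos_of_nonneg hneg.le (by positivity)
    · filter_upwards [ae_restrict_of_ae hF, ae_restrict_mem measurableSet_Ioi] with ξ h hξ
      rw [h, indicator_of_mem hξ]

end Kernel

/-! ### The orthogonality relation -/

section Orthogonality

open scoped InnerProductSpace ComplexConjugate ENNReal

/-- Integration over the upper half-plane in the coordinates `z = x + iy`. -/
theorem lintegral_hypMeasure {F : ℝ × ℝ → ℝ≥0∞} (hF : Measurable F) :
    ∫⁻ z : ℍ, F (z.re, z.im) ∂hypMeasure = ENNReal.ofReal (2 * Real.pi)⁻¹ *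
      ∫⁻ y in Ioi (0 : ℝ), ENNReal.ofReal ((1 / y) ^ 2) * ∫⁻ x, F (x, y) := by
  rw [hypMeasure, lintegral_smul_measure, smul_eq_mul]
  congr 1
  have hw : Measurable fun z : ℍ =>
      (((1 / NNReal.mk z.im z.im_pos.le : NNReal) ^ 2 : NNReal) : ℝ≥0∞) := by
    have : Measurable fun z : ℍ => NNReal.mk z.im z.im_pos.le :=
      UpperHalfPlane.continuous_im.measurable.subtype_mk
    fun_prop
  have hFz : Measurable fun z : ℍ => F (z.re, z.im) :=
    hF.comp (UpperHalfPlane.continuous_re.measurable.prodMk UpperHalfPlane.continuous_im.measurable)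
  rw [UpperHalfPlane.volume_def, lintegral_withDensity_eq_lintegral_mul _ hw hFz]
  set G : ℝ × ℝ → ℝ≥0∞ := fun p => ENNReal.ofReal ((1 / p.2) ^ 2) * F p with hG
  have hGm : Measurable G := by fun_prop
  have h1 : ∀ z : ℍ, ((fun z : ℍ =>
      (((1 / NNReal.mk z.im z.im_pos.le : NNReal) ^ 2 : NNReal) : ℝ≥0∞)) *
      fun z : ℍ => F (z.re, z.im)) z = G (Complex.measurableEquivRealProd (z : ℂ)) := fun z => by
    simp only [hG, Pi.mul_apply, Complex.measurableEquivRealProd_apply]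
    congr 1
    rw [← ENNReal.ofReal_coe_nnreal]
    simp
  have hset : range UpperHalfPlane.coe =
      Complex.measurableEquivRealProd ⁻¹' (univ ×ˢ Ioi (0 : ℝ)) := by
    rw [UpperHalfPlane.range_coe]
    ext c
    simp [UpperHalfPlane.upperHalfPlaneSet, Complex.measurableEquivRealProd_apply]
  simp only [h1]
  rw [← UpperHalfPlane.measurableEmbedding_coe.lintegral_map
      (fun c => G (Complex.measurableEquivRealProd c)),
    UpperHalfPlane.measurableEmbedding_coe.map_comap, hset,
    Complex.volume_preserving_equiv_real_prod.setLIntegral_comp_preimage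
      (MeasurableSet.univ.prod measurableSet_Ioi) hGm, Measure.volume_eq_prod,
    ← Measure.prod_restrict, Measure.restrict_univ, lintegral_prod_symm _ hGm.aemeasurable]
  refine lintegral_congr fun y => ?_
  simp only [hG]
  rw [lintegral_const_mul _ (by fun_prop)]

theorem lintegral_comp_mul_left {c : ℝ} (hc : 0 < c) {h : ℝ → ℝ≥0∞} (hh : Measurable h) :
    ENNReal.ofReal c * ∫⁻ y, h (c * y) = ∫⁻ u, h u := by
  rw [← lintegral_map (μ := volume) hh (measurable_const_mul c), Real.map_volume_mul_left hc.ne',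
    lintegral_smul_measure, smul_eq_mul, ← mul_assoc, ← ENNReal.ofReal_mul hc.le,
    abs_of_pos (inv_pos.mpr hc), mul_inv_cancel₀ hc.ne', ENNReal.ofReal_one, one_mul]

variable (n : ℕ) {α : ℝ} (hα : 0 < α)

/-- The admissibility integral is independent of the frequency, by invariance of `dy / y`. -/
theorem lintegral_norm_sq_windowHat_div {ξ : ℝ} (hξ : 0 < ξ) :
    ∫⁻ y in Ioi (0 : ℝ), ENNReal.ofReal (‖windowHat n α (y * ξ)‖ ^ 2 / y) =
      ENNReal.ofReal (2 * Real.pi) * ENNReal.ofReal (admissibilityConst (psi n α hα)) := by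
  have hc : 0 < 2 * Real.pi * ξ := by positivity
  set h : ℝ → ℝ≥0∞ := fun u => ENNReal.ofReal (‖psiHat n α u‖ ^ 2 / u) with hh
  have hm : Measurable h := by fun_prop
  have h0 : ∀ u ≤ 0, h u = 0 := fun u hu => by simp [hh, psiHat_of_nonpos n α hu]
  have e : ∀ y, ENNReal.ofReal (‖windowHat n α (y * ξ)‖ ^ 2 / y) =
      ENNReal.ofReal (2 * Real.pi) * (ENNReal.ofReal (2 * Real.pi * ξ) *
        h ((2 * Real.pi * ξ) * y)) := fun y => by
    rw [hh, ← ENNReal.ofReal_mul hc.le, ← ENNReal.ofReal_mul (by positivity), norm_sq_windowHat,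
      show 2 * Real.pi * (y * ξ) = 2 * Real.pi * ξ * y by ring]
    congr 1
    rcases eq_or_ne y 0 with rfl | hy
    · simp
    · field_simp
  simp only [e]
  rw [lintegral_const_mul _ (by fun_prop), lintegral_const_mul _ (by fun_prop),
    setLIntegral_eq_of_support_subset, lintegral_comp_mul_left hc hm,
    ← lintegral_norm_sq_psiHat_div n hα, setLIntegral_eq_of_support_subset]
  · intro u hu
    by_contra hn
    exact hu (h0 u (by simpa using hn))
  · intro y hy
    by_contra hn
    refine hy (h0 _ (mul_nonpos_of_nonneg_of_nonpos hc.le (by simpa using hn)))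

theorem measurable_setIntegral_conj_kernelFn (φ : FreqSpace) :
    Measurable fun p : ℝ × ℝ => ∫ ξ in Ioi (0 : ℝ), φ ξ * conj (kernelFn n α p.1 p.2 ξ) := by
  have h1 : Measurable φ := (Lp.stronglyMeasurable φ).measurable
  have h2 : Measurable fun p : (ℝ × ℝ) × ℝ => φ p.2 * conj (kernelFn n α p.1.1 p.1.2 p.2) :=
    (h1.comp measurable_snd).mul (Complex.continuous_conj.measurable.comp
      (measurable_kernelFn n α))
  exact (h2.stronglyMeasurable.integral_prod_right').measurable

theorem measurable_freqTransform (φ : FreqSpace) : Measurable (freqTransform n hα φ) := by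
  have h := (measurable_setIntegral_conj_kernelFn n (α := α) φ).comp
    (UpperHalfPlane.continuous_re.measurable.prodMk UpperHalfPlane.continuous_im.measurable)
  convert! h using 1
  funext z
  exact freqTransform_eq_setIntegral n hα φ z

/-- On each horizontal line the transform is an inverse Fourier integral, to which Plancherel's
theorem applies. -/
theorem lintegral_horizontal {α : ℝ} (hα : 0 < α) (φ : FreqSpace) {y : ℝ} (hy : 0 < y) :
    ∫⁻ x, ‖∫ ξ in Ioi (0 : ℝ), φ ξ * conj (kernelFn n α x y ξ)‖ₑ ^ 2 =
      ∫⁻ ξ in Ioi (0 : ℝ), ‖φ ξ‖ₑ ^ 2 * ENNReal.ofReal (y * ‖windowHat n α (y * ξ)‖ ^ 2) := by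
  set g : ℝ → ℂ := (Ioi (0 : ℝ)).indicator fun ξ => φ ξ * conj (kernelFn n α 0 y ξ) with hg
  have hk := (memLp_kernelFn n hα 0 hy).restrict (Ioi 0)
  have hkm : Measurable fun ξ => conj (kernelFn n α 0 y ξ) :=
    Complex.continuous_conj.measurable.comp (measurable_kernelFn_right n α 0 y)
  have hks : MemLp (fun ξ => conj (kernelFn n α 0 y ξ)) 2 (volume.restrict (Ioi 0)) :=
    hk.of_le hkm.aestronglyMeasurable (ae_of_all _ fun ξ => by simp)
  have hg1 : Integrable g :=
    (integrable_indicator_iff measurableSet_Ioi).mpr ((Lp.memLp φ).integrable_mul hks)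
  obtain ⟨M, hM⟩ := exists_norm_psiHat_le n hα
  have hg2 : MemLp g 2 := by
    rw [hg, memLp_indicator_iff_restrict measurableSet_Ioi]
    refine (Lp.memLp φ).of_le_mul (c := √y * (√(2 * Real.pi) * M))
      ((Lp.aestronglyMeasurable φ).mul hkm.aestronglyMeasurable) (ae_of_all _ fun ξ => ?_)
    rw [norm_mul, mul_comm, RCLike.norm_conj, norm_kernelFn, windowHat, norm_mul, Complex.norm_real,
      Real.norm_of_nonneg (Real.sqrt_nonneg _)]
    gcongr
    exact hM _
  have hF : ∀ x, ∫ ξ in Ioi (0 : ℝ), φ ξ * conj (kernelFn n α x y ξ) = 𝓕⁻ g x := fun x => by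
    rw [Real.fourierInv_eq', ← integral_indicator measurableSet_Ioi]
    refine integral_congr_ae (ae_of_all _ fun ξ => ?_)
    by_cases hξ : ξ ∈ Ioi (0 : ℝ)
    · simp only [hg, indicator_of_mem hξ, kernelFn, map_mul, Complex.conj_ofReal, ← Complex.exp_conj,
        Complex.conj_I, smul_eq_mul, RCLike.inner_apply, conj_trivial]
      simp only [mul_zero, zero_mul, neg_zero, Complex.ofReal_zero, Complex.exp_zero, mul_one]
      rw [show ((-(2 * Real.pi * x * ξ) : ℝ) : ℂ) * -Complex.I =
        ((2 * Real.pi * (x * ξ) : ℝ) : ℂ) * Complex.I by push_cast; ring]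
      ring
    · simp only [hg, indicator_of_notMem hξ, smul_zero]
  simp only [hF]
  rw [lintegral_enorm_sq_fourierInv hg1 hg2, ← lintegral_indicator measurableSet_Ioi]
  refine lintegral_congr fun ξ => ?_
  by_cases hξ : ξ ∈ Ioi (0 : ℝ)
  · simp only [hg, indicator_of_mem hξ]
    rw [enorm_mul, mul_pow]
    congr 1
    rw [← ofReal_norm, ← ENNReal.ofReal_pow (norm_nonneg _), RCLike.norm_conj, norm_kernelFn, mul_pow,
      Real.sq_sqrt hy.le]
  · simp only [hg, indicator_of_notMem hξ]
    simp

/-- The orthogonality relation `∫ |W_ψ φ|² dμ = C_ψ ‖φ‖²`. -/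
theorem lintegral_enorm_sq_freqTransform (φ : FreqSpace) :
    ∫⁻ z, ‖freqTransform n hα φ z‖ₑ ^ 2 ∂hypMeasure =
      ENNReal.ofReal (admissibilityConst (psi n α hα)) * ‖φ‖ₑ ^ 2 := by
  have hφm : Measurable φ := (Lp.stronglyMeasurable φ).measurable
  simp only [freqTransform_eq_setIntegral]
  rw [lintegral_hypMeasure
    (F := fun p => ‖∫ ξ in Ioi (0 : ℝ), φ ξ * conj (kernelFn n α p.1 p.2 ξ)‖ₑ ^ 2)
    ((measurable_setIntegral_conj_kernelFn n φ).enorm.pow_const 2)]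
  have h1 : ∫⁻ y in Ioi (0 : ℝ), ENNReal.ofReal ((1 / y) ^ 2) *
      ∫⁻ x, ‖∫ ξ in Ioi (0 : ℝ), φ ξ * conj (kernelFn n α x y ξ)‖ₑ ^ 2 =
      ∫⁻ y in Ioi (0 : ℝ), ∫⁻ ξ in Ioi (0 : ℝ), ‖φ ξ‖ₑ ^ 2 *
        ENNReal.ofReal (‖windowHat n α (y * ξ)‖ ^ 2 / y) := by
    refine setLIntegral_congr_fun measurableSet_Ioi fun y hy => ?_
    have hy0 : (0 : ℝ) < y := hy
    simp only [lintegral_horizontal n hα φ hy0]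
    rw [← lintegral_const_mul _ (by fun_prop)]
    refine lintegral_congr fun ξ => ?_
    rw [mul_left_comm, ← ENNReal.ofReal_mul (by positivity)]
    congr 2
    field_simp
  rw [h1, lintegral_lintegral_swap (by fun_prop)]
  have h2 : ∫⁻ ξ in Ioi (0 : ℝ), ∫⁻ y in Ioi (0 : ℝ), ‖φ ξ‖ₑ ^ 2 *
        ENNReal.ofReal (‖windowHat n α (y * ξ)‖ ^ 2 / y) =
      ∫⁻ ξ in Ioi (0 : ℝ), ‖φ ξ‖ₑ ^ 2 * (ENNReal.ofReal (2 * Real.pi) *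
        ENNReal.ofReal (admissibilityConst (psi n α hα))) := by
    refine setLIntegral_congr_fun measurableSet_Ioi fun ξ hξ => ?_
    rw [lintegral_const_mul _ (by fun_prop), lintegral_norm_sq_windowHat_div n hα hξ]
  have h3 : ∫⁻ ξ in Ioi (0 : ℝ), ‖φ ξ‖ₑ ^ 2 = ‖φ‖ₑ ^ 2 := by
    rw [Lp.enorm_def, eLpNorm_eq_lintegral_rpow_enorm_toReal (by norm_num) (by norm_num),
      ← ENNReal.rpow_natCast _ 2, ← ENNReal.rpow_mul]
    norm_num
  rw [h2, lintegral_mul_const _ (by fun_prop), h3, mul_comm, mul_assoc, mul_right_comm,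
    ← ENNReal.ofReal_mul (by positivity), mul_inv_cancel₀ (by positivity), ENNReal.ofReal_one, one_mul,
    mul_comm]

end Orthogonality

section Isometry

open scoped InnerProductSpace ComplexConjugate ENNReal

variable (n : ℕ) {α : ℝ} (hα : 0 < α)

theorem memLp_freqTransform (φ : FreqSpace) : MemLp (freqTransform n hα φ) 2 hypMeasure := by
  refine ⟨(measurable_freqTransform n hα φ).aestronglyMeasurable, ?_⟩
  have h := lintegral_enorm_sq_freqTransform n hα φ
  rw [eLpNorm_lt_top_iff_lintegral_rpow_enorm_lt_top (by norm_num) (by norm_num)]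
  simp only [ENNReal.toReal_ofNat, ENNReal.rpow_ofNat]
  rw [h]
  exact ENNReal.mul_lt_top ENNReal.ofReal_lt_top (by simp)

theorem l2NormSq_freqTransform (φ : FreqSpace) :
    l2NormSq (freqTransform n hα φ) = admissibilityConst (psi n α hα) * ‖φ‖ ^ 2 := by
  have hC := (admissibilityConst_pos n hα).le
  rw [l2NormSq, integral_eq_lintegral_of_nonneg_ae (ae_of_all _ fun z => by positivity)
    ((measurable_freqTransform n hα φ).norm.pow_const 2).aestronglyMeasurable]
  have h : ∀ z, ENNReal.ofReal (‖freqTransform n hα φ z‖ ^ 2) = ‖freqTransform n hα φ z‖ₑ ^ 2 :=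
    fun z => by rw [ENNReal.ofReal_pow (norm_nonneg _), ofReal_norm]
  simp only [h]
  rw [lintegral_enorm_sq_freqTransform, ENNReal.toReal_mul, ENNReal.toReal_ofReal hC,
    ENNReal.toReal_pow, toReal_enorm]

theorem freqTransform_add (φ φ' : FreqSpace) :
    freqTransform n hα (φ + φ') = freqTransform n hα φ + freqTransform n hα φ' :=
  funext fun _ => inner_add_right _ _ _

theorem freqTransform_smul (c : ℂ) (φ : FreqSpace) :
    freqTransform n hα (c • φ) = c • freqTransform n hα φ :=
  funext fun _ => inner_smul_right _ _ _

theorem freqTransform_injective : Function.Injective (freqTransform n hα) := by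
  intro φ φ' h
  have h1 : freqTransform n hα (φ - φ') = 0 := by
    funext z
    exact (inner_sub_right _ _ _).trans (sub_eq_zero.mpr (congrFun h z))
  have h2 := l2NormSq_freqTransform n hα (φ - φ')
  simp only [h1, l2NormSq, Pi.zero_apply, norm_zero, ne_eq, OfNat.ofNat_ne_zero, not_false_eq_true,
    zero_pow, integral_zero] at h2
  have h3 := (mul_eq_zero.mp h2.symm).resolve_left (admissibilityConst_pos n hα).ne'
  exact sub_eq_zero.mp (by simpa using h3)

/-- The polarised orthogonality relation. -/
theorem l2Inner_freqTransform (φ φ' : FreqSpace) :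
    l2Inner (freqTransform n hα φ) (freqTransform n hα φ') =
      (admissibilityConst (psi n α hα) : ℂ) * ⟪φ', φ⟫_ℂ := by
  set T : FreqSpace →ₗ[ℂ] Lp ℂ 2 hypMeasure :=
    { toFun := fun φ => (memLp_freqTransform n hα φ).toLp _
      map_add' := fun φ φ' => by
        rw [← MemLp.toLp_add]
        exact MemLp.toLp_congr _ _ (by rw [freqTransform_add])
      map_smul' := fun c φ => by
        rw [RingHom.id_apply, ← MemLp.toLp_const_smul]
        exact MemLp.toLp_congr _ _ (by rw [freqTransform_smul]) } with hT
  have hn : ∀ φ, ‖T φ‖ ^ 2 = admissibilityConst (psi n α hα) * ‖φ‖ ^ 2 := fun φ => by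
    rw [← l2NormSq_freqTransform n hα φ]
    exact norm_toLp_sq (memLp_freqTransform n hα φ)
  have h1 : l2Inner (freqTransform n hα φ) (freqTransform n hα φ') = ⟪T φ', T φ⟫_ℂ := by
    rw [L2.inner_def]
    refine integral_congr_ae ?_
    filter_upwards [(memLp_freqTransform n hα φ).coeFn_toLp,
      (memLp_freqTransform n hα φ').coeFn_toLp] with z h h'
    change _ = ⟪(memLp_freqTransform n hα φ').toLp _ z, (memLp_freqTransform n hα φ).toLp _ z⟫_ℂ
    rw [h, h', RCLike.inner_apply]
    rfl
  have hn' : ∀ φ, ((‖T φ‖ : ℝ) : ℂ) ^ 2 = (admissibilityConst (psi n α hα) : ℂ) * (‖φ‖ : ℂ) ^ 2 :=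
    fun φ => by exact_mod_cast congrArg (fun x : ℝ => (x : ℂ)) (hn φ)
  rw [h1, inner_eq_sum_norm_sq_div_four, inner_eq_sum_norm_sq_div_four]
  simp only [← map_add, ← map_sub, ← map_smul, RCLike.ofReal_eq_complex_ofReal, hn']
  ring

end Isometry

/-! ### The Möbius action and the automorphy factor -/

section Automorphy

open UpperHalfPlane

theorem smulInvariantMeasure_hypMeasure : SMulInvariantMeasure (GL (Fin 2) ℝ) ℍ hypMeasure := by
  unfold hypMeasure; infer_instance

theorem measurePreserving_smul_SL (m : SL(2, ℝ)) :
    MeasurePreserving (fun z : ℍ => m • z) hypMeasure hypMeasure := by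
  have := smulInvariantMeasure_hypMeasure
  exact measurePreserving_smul (Matrix.SpecialLinearGroup.toGL m) hypMeasure

/-- A continuous logarithm of a constant function on `ℍ` is constant. -/
theorem eq_of_exp_eq {h : ℍ → ℂ} (hc : Continuous h)
    (he : ∀ z z', Complex.exp (h z) = Complex.exp (h z')) (z z' : ℍ) : h z = h z' := by
  choose k hk using fun z => Complex.exp_eq_exp_iff_exists_int.mp (he z z')
  have hcont : Continuous k := by
    rw [Int.isClosedEmbedding_coe_real.isEmbedding.continuous_iff]
    have e : ((↑) : ℤ → ℝ) ∘ k = fun z => ((h z - h z') / (2 * Real.pi * Complex.I)).re := by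
      funext z
      have : h z - h z' = ((k z : ℝ) : ℂ) * (2 * Real.pi * Complex.I) := by
        rw [hk z]; push_cast; ring
      rw [this, mul_div_cancel_right₀ _ Complex.two_pi_I_ne_zero, Complex.ofReal_re]
      rfl
    rw [e]
    fun_prop
  have h0 : (k z' : ℂ) * (2 * Real.pi * Complex.I) = 0 := by
    have := hk z'
    linear_combination -this
  have h1 : k z = k z' := PreconnectedSpace.constant inferInstance hcont
  rw [hk z, h1, h0, add_zero]

/-- The denominator `cz + d` of the Möbius transformation `m`. -/
def mden (m : SL(2, ℝ)) (z : ℍ) : ℂ := (m 1 0 : ℂ) * z + (m 1 1 : ℂ)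

theorem det_SL (m : SL(2, ℝ)) : m 0 0 * m 1 1 - m 0 1 * m 1 0 = 1 := by
  rw [← Matrix.det_fin_two]; exact m.2

theorem mden_ne_zero (m : SL(2, ℝ)) (z : ℍ) : mden m z ≠ 0 := by
  intro h
  have him := congrArg Complex.im h
  have hre := congrArg Complex.re h
  simp [mden] at him hre
  rcases him with h1 | h1
  · have h2 := det_SL m
    rw [h1] at hre h2
    simp at hre
    simp [hre] at h2
  · exact z.im_ne_zero h1

theorem coe_smul_SL (m : SL(2, ℝ)) (z : ℍ) :
    ((m • z : ℍ) : ℂ) = ((m 0 0 : ℂ) * z + (m 0 1 : ℂ)) / mden m z := by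
  rw [coe_specialLinearGroup_apply]; rfl

theorem mden_mul (m m' : SL(2, ℝ)) (z : ℍ) :
    mden (m * m') z = mden m (m' • z) * mden m' z := by
  have := mden_ne_zero m' z
  rw [mden, mden, coe_smul_SL]
  field_simp
  simp [Matrix.mul_apply, Fin.sum_univ_two, mden]
  ring

theorem im_smul_SL (m : SL(2, ℝ)) (z : ℍ) : (m • z).im = z.im / ‖mden m z‖ ^ 2 := by
  have h := UpperHalfPlane.im_smul_eq_div_normSq (Matrix.SpecialLinearGroup.toGL m) z
  rw [Complex.normSq_eq_norm_sq] at h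
  simpa [mden, denom] using! h

/-- The continuous logarithm of `|cz + d| / (cz + d)`. -/
def mlog (m : SL(2, ℝ)) (z : ℍ) : ℂ := Complex.log (((‖mden m z‖ : ℝ) : ℂ) / mden m z)

theorem norm_div_ne_zero {w : ℂ} (hw : w ≠ 0) : ((‖w‖ : ℝ) : ℂ) / w ≠ 0 := by
  simp [hw]

theorem exp_mlog (m : SL(2, ℝ)) (z : ℍ) :
    Complex.exp (mlog m z) = ((‖mden m z‖ : ℝ) : ℂ) / mden m z :=
  Complex.exp_log (norm_div_ne_zero (mden_ne_zero m z))

theorem continuous_mden (m : SL(2, ℝ)) : Continuous (mden m) := by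
  unfold mden
  have := continuous_coe
  fun_prop

theorem continuous_mlog (m : SL(2, ℝ)) : Continuous (mlog m) := by
  by_cases h : m 1 0 = 0
  · have : mlog m = fun _ => Complex.log (((‖(m 1 1 : ℂ)‖ : ℝ) : ℂ) / (m 1 1 : ℂ)) := by
      funext z
      simp [mlog, mden, h]
    rw [this]
    exact continuous_const
  · have hc : Continuous fun z => ((‖mden m z‖ : ℝ) : ℂ) / mden m z :=
      (Complex.continuous_ofReal.comp (continuous_mden m).norm).div (continuous_mden m)
        (mden_ne_zero m)
    refine hc.clog fun z => ?_
    rw [Complex.mem_slitPlane_iff]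
    right
    have h1 : (mden m z).im ≠ 0 := by
      have := z.im_ne_zero
      simp [mden, h, this]
    have h2 := mden_ne_zero m z
    rw [Complex.div_im]
    simp [h1, h2]

/-- The automorphy factor `(|cz + d| / (cz + d)) ^ σ`, with the principal branch. -/
def autFactor (σ : ℝ) (m : SL(2, ℝ)) (z : ℍ) : ℂ :=
  (((‖mden m z‖ : ℝ) : ℂ) / mden m z) ^ (σ : ℂ)

theorem autFactor_eq_exp (σ : ℝ) (m : SL(2, ℝ)) (z : ℍ) :
    autFactor σ m z = Complex.exp (mlog m z * σ) :=
  Complex.cpow_def_of_ne_zero (norm_div_ne_zero (mden_ne_zero m z)) _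

theorem norm_autFactor (σ : ℝ) (m : SL(2, ℝ)) (z : ℍ) : ‖autFactor σ m z‖ = 1 := by
  have h : ‖((‖mden m z‖ : ℝ) : ℂ) / mden m z‖ = 1 := by
    rw [norm_div, Complex.norm_real, norm_norm, div_self (norm_ne_zero_iff.mpr (mden_ne_zero m z))]
  rw [autFactor, Complex.norm_cpow_of_ne_zero (norm_div_ne_zero (mden_ne_zero m z)), h]
  simp

/-- The automorphy factor is a cocycle up to a unimodular constant. -/
theorem autFactor_mul (σ : ℝ) (m m' : SL(2, ℝ)) : ∃ c : ℂ, ‖c‖ = 1 ∧ ∀ z,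
    autFactor σ m (m' • z) * autFactor σ m' z = c * autFactor σ (m * m') z := by
  set h : ℍ → ℂ := fun z => mlog m (m' • z) + mlog m' z - mlog (m * m') z with hh
  have hsmul : Continuous fun z : ℍ => m' • z := by fun_prop
  have hc : Continuous h := (((continuous_mlog m).comp hsmul).add (continuous_mlog m')).sub
    (continuous_mlog _)
  have he : ∀ z, Complex.exp (h z) = 1 := fun z => by
    simp only [hh]
    have h1 := mden_ne_zero m (m' • z)
    have h2 := mden_ne_zero m' z
    rw [Complex.exp_sub, Complex.exp_add, exp_mlog, exp_mlog, exp_mlog, mden_mul, norm_mul]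
    have h3 : ((‖mden m (m' • z)‖ : ℝ) : ℂ) ≠ 0 := by simpa using h1
    have h4 : ((‖mden m' z‖ : ℝ) : ℂ) ≠ 0 := by simpa using h2
    push_cast
    field_simp
  have key : ∀ z, autFactor σ m (m' • z) * autFactor σ m' z =
      Complex.exp (h I * σ) * autFactor σ (m * m') z := fun z => by
    rw [eq_of_exp_eq hc (fun z z' => by rw [he, he]) I z, autFactor_eq_exp, autFactor_eq_exp,
      autFactor_eq_exp, ← Complex.exp_add, ← Complex.exp_add]
    simp only [hh]
    congr 1
    ring
  refine ⟨_, ?_, key⟩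
  have := congrArg norm (key I)
  simpa only [norm_mul, norm_autFactor, mul_one] using this.symm

theorem tau_eq (n : ℕ) (α : ℝ) (g : SL(2, ℝ)) (F : ℍ → ℂ) (z : ℍ) :
    tau n α g F z = autFactor (2 * n + α + 1) g⁻¹ z * F (g⁻¹ • z) := rfl

theorem norm_tau (n : ℕ) (α : ℝ) (g : SL(2, ℝ)) (F : ℍ → ℂ) (z : ℍ) :
    ‖tau n α g F z‖ = ‖F (g⁻¹ • z)‖ := by
  rw [tau_eq, norm_mul, norm_autFactor, one_mul]

theorem tau_tau (n : ℕ) (α : ℝ) (g g' : SL(2, ℝ)) : ∃ c : ℂ, ‖c‖ = 1 ∧ ∀ F,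
    tau n α g (tau n α g' F) = c • tau n α (g * g') F := by
  obtain ⟨c, hc, h⟩ := autFactor_mul (2 * n + α + 1) g'⁻¹ g⁻¹
  refine ⟨c, hc, fun F => funext fun z => ?_⟩
  rw [Pi.smul_apply, tau_eq, tau_eq, tau_eq, mul_inv_rev, mul_smul, smul_eq_mul, ← mul_assoc,
    ← mul_assoc, ← h]
  ring

theorem eq_or_eq_neg_of_mk_eq {g g' : SL(2, ℝ)} (h : (g : PSL(2, ℝ)) = g') :
    g' = g ∨ g' = -g := by
  have h1 : g⁻¹ * g' ∈ Subgroup.center SL(2, ℝ) := QuotientGroup.eq.mp h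
  obtain ⟨r, hr, hg⟩ := Matrix.SpecialLinearGroup.mem_center_iff.mp h1
  have hr2 : r ^ 2 = 1 := by simpa using hr
  rcases mul_self_eq_one_iff.mp ((sq r).symm.trans hr2) with h | h
  · left
    have : g⁻¹ * g' = 1 := by
      ext i j
      rw [← hg, h]; simp
    exact (inv_mul_eq_one.mp this).symm
  · right
    have : g⁻¹ * g' = -1 := by
      ext i j
      rw [← hg, h]
      fin_cases i <;> fin_cases j <;> simp
    rw [inv_mul_eq_iff_eq_mul.mp this]
    simp

/-- Two representatives of the same element of `PSL(2, ℝ)` act by the same operator up to phase. -/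
theorem tau_congr (n : ℕ) (α : ℝ) {g g' : SL(2, ℝ)} (h : (g : PSL(2, ℝ)) = g') :
    ∃ c : ℂ, ‖c‖ = 1 ∧ ∀ F, tau n α g' F = c • tau n α g F := by
  have hsmul : ∀ z : ℍ, g'⁻¹ • z = g⁻¹ • z := fun z => by
    rw [← psl_mk_smul, ← psl_mk_smul, QuotientGroup.mk_inv, QuotientGroup.mk_inv, h]
  rcases eq_or_eq_neg_of_mk_eq h with rfl | rfl
  · exact ⟨1, norm_one, fun F => (one_smul _ _).symm⟩
  · obtain ⟨c, hc, hmul⟩ := autFactor_mul (2 * n + α + 1) (-1) g⁻¹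
    have hconst : ∀ z, autFactor (2 * n + α + 1) (-1) z = autFactor (2 * n + α + 1) (-1) I :=
      fun z => by simp [autFactor, mden]
    have hinv : (-g)⁻¹ = -1 * g⁻¹ := by
      rw [inv_eq_iff_mul_eq_one]
      simp
    have hc0 : c ≠ 0 := norm_ne_zero_iff.mp (hc.symm ▸ one_ne_zero)
    refine ⟨c⁻¹ * autFactor (2 * n + α + 1) (-1) I, ?_, fun F => funext fun z => ?_⟩
    · rw [norm_mul, norm_inv, hc, norm_autFactor, inv_one, mul_one]
    · have h1 := hmul z
      rw [hconst] at h1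
      rw [Pi.smul_apply, tau_eq, tau_eq, hsmul, hinv, smul_eq_mul, ← mul_assoc, mul_assoc c⁻¹, h1,
        inv_mul_cancel_left₀ hc0]

end Automorphy

/-! ### The Laplace transform of powers -/

section Laplace

open Filter Topology

theorem norm_cexp_neg_mul (s : ℂ) (ξ : ℝ) : ‖Complex.exp (-s * ξ)‖ = Real.exp (-s.re * ξ) := by
  rw [Complex.norm_exp]; simp

theorem integrableOn_rpow_mul_exp_neg {β b : ℝ} (hβ : -1 < β) (hb : 0 < b) :
    IntegrableOn (fun ξ : ℝ => ξ ^ β * Real.exp (-b * ξ)) (Ioi 0) := by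
  simpa using integrableOn_rpow_mul_exp_neg_mul_rpow (s := β) (p := 1) hβ one_pos hb

theorem integrableOn_rpow_mul_cexp_neg {β : ℝ} (hβ : -1 < β) {s : ℂ} (hs : 0 < s.re) :
    IntegrableOn (fun ξ : ℝ => ((ξ ^ β : ℝ) : ℂ) * Complex.exp (-s * ξ)) (Ioi 0) := by
  refine Integrable.mono' (integrableOn_rpow_mul_exp_neg hβ hs)
    (by apply Measurable.aestronglyMeasurable; fun_prop) ?_
  filter_upwards [ae_restrict_mem measurableSet_Ioi] with ξ hξ
  have hξ0 : (0 : ℝ) < ξ := hξ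
  rw [norm_mul, norm_cexp_neg_mul, Complex.norm_real, Real.norm_of_nonneg (by positivity)]

theorem differentiableAt_laplace {β : ℝ} (hβ : -1 < β) {s : ℂ} (hs : 0 < s.re) :
    DifferentiableAt ℂ
      (fun s : ℂ => ∫ ξ in Ioi (0 : ℝ), ((ξ ^ β : ℝ) : ℂ) * Complex.exp (-s * ξ)) s := by
  have hU : {w : ℂ | s.re / 2 < w.re} ∈ 𝓝 s :=
    (isOpen_lt continuous_const Complex.continuous_re).mem_nhds (by
      change s.re / 2 < s.re; linarith)
  refine (hasDerivAt_integral_of_dominated_loc_of_deriv_le (μ := volume.restrict (Ioi (0 : ℝ)))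
    (F := fun (w : ℂ) (ξ : ℝ) => ((ξ ^ β : ℝ) : ℂ) * Complex.exp (-w * ξ))
    (s := {w : ℂ | s.re / 2 < w.re})
    (bound := fun ξ : ℝ => ξ ^ (β + 1) * Real.exp (-(s.re / 2) * ξ))
    (F' := fun w ξ => ((ξ ^ β : ℝ) : ℂ) * (Complex.exp (-w * ξ) * (-ξ)))
    hU (Eventually.of_forall fun w => by apply Measurable.aestronglyMeasurable; fun_prop)
    (integrableOn_rpow_mul_cexp_neg hβ hs)
    (by apply Measurable.aestronglyMeasurable; fun_prop) ?_
    (integrableOn_rpow_mul_exp_neg (by linarith) (by linarith)) ?_).2.differentiableAt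
  · filter_upwards [ae_restrict_mem measurableSet_Ioi] with ξ hξ w hw
    have hξ0 : (0 : ℝ) < ξ := hξ
    have hw' : s.re / 2 < w.re := hw
    rw [norm_mul, norm_mul, norm_cexp_neg_mul, Complex.norm_real, norm_neg, Complex.norm_real,
      Real.norm_of_nonneg (by positivity), Real.norm_of_nonneg hξ0.le, Real.rpow_add_one hξ0.ne']
    have : Real.exp (-w.re * ξ) ≤ Real.exp (-(s.re / 2) * ξ) := by
      apply Real.exp_le_exp.mpr
      nlinarith
    calc ξ ^ β * (Real.exp (-w.re * ξ) * ξ) = ξ ^ β * ξ * Real.exp (-w.re * ξ) := by ring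
      _ ≤ _ := by gcongr
  · filter_upwards with ξ w _
    have h := ((hasDerivAt_id w).neg.mul_const (ξ : ℂ)).cexp.const_mul ((ξ ^ β : ℝ) : ℂ)
    simpa using! h

/-- `∫₀^∞ ξ^β e^(-sξ) dξ = Γ(β + 1) s^(-(β + 1))` in the right half-plane, by analytic continuation
from the positive axis. -/
theorem integral_rpow_mul_cexp_neg {β : ℝ} (hβ : -1 < β) {s : ℂ} (hs : 0 < s.re) :
    ∫ ξ in Ioi (0 : ℝ), ((ξ ^ β : ℝ) : ℂ) * Complex.exp (-s * ξ) =
      (Real.Gamma (β + 1) : ℂ) * s ^ (-((β + 1 : ℝ) : ℂ)) := by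
  have hopen : IsOpen {w : ℂ | 0 < w.re} := isOpen_lt continuous_const Complex.continuous_re
  have h1 : AnalyticOnNhd ℂ
      (fun s : ℂ => ∫ ξ in Ioi (0 : ℝ), ((ξ ^ β : ℝ) : ℂ) * Complex.exp (-s * ξ))
      {w : ℂ | 0 < w.re} :=
    DifferentiableOn.analyticOnNhd
      (fun w hw => (differentiableAt_laplace hβ hw).differentiableWithinAt) hopen
  have h2 : AnalyticOnNhd ℂ (fun s : ℂ => (Real.Gamma (β + 1) : ℂ) * s ^ (-((β + 1 : ℝ) : ℂ)))
      {w : ℂ | 0 < w.re} := by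
    refine DifferentiableOn.analyticOnNhd (fun w hw => ?_) hopen
    exact ((differentiableAt_id.cpow_const (Or.inl hw)).const_mul _).differentiableWithinAt
  have hpos : ∀ b : ℝ, 0 < b →
      ∫ ξ in Ioi (0 : ℝ), ((ξ ^ β : ℝ) : ℂ) * Complex.exp (-(b : ℂ) * ξ) =
      (Real.Gamma (β + 1) : ℂ) * (b : ℂ) ^ (-((β + 1 : ℝ) : ℂ)) := fun b hb => by
    have h := integral_rpow_mul_exp_neg_mul_rpow (p := 1) (q := β) (b := b) one_pos hβ hb
    simp only [Real.rpow_one, div_one, mul_one] at h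
    rw [← Complex.ofReal_neg, ← Complex.ofReal_neg, ← Complex.ofReal_cpow hb.le, ← Complex.ofReal_mul,
      mul_comm, ← h,
      ← integral_complex_ofReal]
    refine integral_congr_ae (ae_of_all _ fun ξ => ?_)
    push_cast
    rfl
  have hconv : IsPreconnected {w : ℂ | 0 < w.re} :=
    (convex_halfSpace_re_gt 0).isPreconnected
  have hfreq : ∃ᶠ w in 𝓝[≠] (1 : ℂ),
      ∫ ξ in Ioi (0 : ℝ), ((ξ ^ β : ℝ) : ℂ) * Complex.exp (-w * ξ) =
      (Real.Gamma (β + 1) : ℂ) * w ^ (-((β + 1 : ℝ) : ℂ)) := by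
    have ht : Tendsto (fun b : ℝ => (b : ℂ)) (𝓝[≠] 1) (𝓝[≠] 1) := by
      refine tendsto_nhdsWithin_of_tendsto_nhds_of_eventually_within _ ?_ ?_
      · exact (Complex.continuous_ofReal.tendsto' 1 1 (by simp)).mono_left nhdsWithin_le_nhds
      · filter_upwards [self_mem_nhdsWithin] with b hb
        simpa using hb
    have hev : ∀ᶠ b : ℝ in 𝓝[≠] 1, 0 < b :=
      nhdsWithin_le_nhds (lt_mem_nhds one_pos)
    exact ht.frequently (hev.mono hpos).frequently
  exact h1.eqOn_of_preconnected_of_frequently_eq h2 hconv (z₀ := 1) (by simp) hfreq hs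

end Laplace

/-! ### The transforms of exponentials -/

section Exponentials

open scoped InnerProductSpace ComplexConjugate

variable (n : ℕ) {α : ℝ} (hα : 0 < α)

/-- The function `ξ ↦ ξ^(α/2) e^(2πiξw)`. -/
def expFn (α : ℝ) (w : ℍ) (ξ : ℝ) : ℂ :=
  ((ξ ^ (α / 2) : ℝ) : ℂ) * Complex.exp (2 * Real.pi * Complex.I * w * ξ)

@[fun_prop]
theorem measurable_expFn (w : ℍ) : Measurable (expFn α w) := by
  unfold expFn; fun_prop

theorem norm_expFn (w : ℍ) {ξ : ℝ} (hξ : 0 < ξ) :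
    ‖expFn α w ξ‖ = ξ ^ (α / 2) * Real.exp (-(2 * Real.pi * w.im) * ξ) := by
  rw [expFn, norm_mul, Complex.norm_real, Real.norm_of_nonneg (by positivity), Complex.norm_exp]
  congr 2
  simp

theorem memLp_expFn {α : ℝ} (hα : 0 < α) (w : ℍ) :
    MemLp (expFn α w) 2 (volume.restrict (Ioi 0)) := by
  rw [memLp_two_iff_integrable_sq_norm (measurable_expFn w).aestronglyMeasurable]
  have := w.im_pos
  refine IntegrableOn.congr_fun (integrableOn_rpow_mul_exp_neg (β := α)
    (b := 2 * (2 * Real.pi * w.im)) (by linarith) (by positivity)) (fun ξ hξ => ?_)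
    measurableSet_Ioi
  have hξ0 : (0 : ℝ) < ξ := hξ
  rw [norm_expFn w hξ0, mul_pow, ← Real.rpow_natCast (ξ ^ _), ← Real.rpow_mul hξ0.le,
    ← Real.exp_nat_mul]
  congr 2 <;> push_cast <;> ring

/-- The exponential `ξ ↦ ξ^(α/2) e^(2πiξw)` as an element of the frequency-side Hardy space. -/
def expVec (w : ℍ) : FreqSpace := (memLp_expFn hα w).toLp _

/-- The transform of the exponential `ξ^(α/2) e^(2πiξw)` at the point `z`, up to a constant factor
depending only on `n` and `α` (`freqTransform_expVec`). The base of the complex power lies in the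
right half-plane. -/
def expTransform (n : ℕ) (α : ℝ) (w z : ℍ) : ℂ :=
  (((2 * Real.pi * z.im) ^ ((α + 1) / 2) : ℝ) : ℂ) *
    (-(2 * Real.pi * Complex.I * (w + z))) ^ (-((α + 1 : ℝ) : ℂ)) *
    ((w + conj (z : ℂ)) / (w + z)) ^ n

theorem add_coe_ne_zero (w z : ℍ) : (w : ℂ) + z ≠ 0 := by
  intro h
  have h1 := congrArg Complex.im h
  have := w.im_pos
  have := z.im_pos
  simp at h1
  linarith

theorem re_exponent_pos (w z : ℍ) : 0 < (-(2 * Real.pi * Complex.I * (w + z)) : ℂ).re := by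
  have := w.im_pos
  have := z.im_pos
  simp
  positivity

/-- The Laplace transforms of the monomials of the Laguerre polynomial sum up by the binomial
theorem. -/
theorem freqTransform_expVec (w z : ℍ) :
    freqTransform n hα (expVec hα w) z =
      (Real.Gamma (n + α + 1) / n.factorial : ℝ) * expTransform n α w z := by
  set s : ℂ := -(2 * Real.pi * Complex.I * (w + z)) with hs
  have hsre : 0 < s.re := re_exponent_pos w z
  have hs0 : s ≠ 0 := fun h => by simp [h] at hsre
  have hy := z.im_pos
  set Y : ℝ := 2 * Real.pi * z.im with hY
  have hY0 : 0 < Y := by positivity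
  set c : ℕ → ℝ := fun k => (-1) ^ k * (Real.Gamma (n + α + 1) /
    (Real.Gamma (k + α + 1) * (n - k).factorial)) * ((2 * Y) ^ k / k.factorial) with hc
  have h1 : freqTransform n hα (expVec hα w) z = ∫ ξ in Ioi (0 : ℝ), ((Y ^ ((α + 1) / 2) : ℝ) : ℂ) *
      ∑ k ∈ Finset.range (n + 1), (c k : ℂ) *
        (((ξ ^ (α + k) : ℝ) : ℂ) * Complex.exp (-s * ξ)) := by
    rw [freqTransform_eq_setIntegral]
    refine integral_congr_ae ?_
    filter_upwards [(memLp_expFn hα w).coeFn_toLp, ae_restrict_mem measurableSet_Ioi] with ξ hξ1 hξ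
    have hξ0 : (0 : ℝ) < ξ := hξ
    have hreal : ξ ^ (α / 2) * (√z.im * (√(2 * Real.pi) *
        ((Y * ξ) ^ (α / 2) * laguerre n α (2 * (Y * ξ))))) =
        Y ^ ((α + 1) / 2) * ∑ k ∈ Finset.range (n + 1), c k * ξ ^ (α + k) := by
      have e1 : √z.im * √(2 * Real.pi) * Y ^ (α / 2) = Y ^ ((α + 1) / 2) := by
        rw [← Real.sqrt_mul hy.le, mul_comm z.im, ← hY, Real.sqrt_eq_rpow, ← Real.rpow_add hY0]
        congr 1; ring
      have e2 : ξ ^ (α / 2) * ξ ^ (α / 2) = ξ ^ α := by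
        rw [← Real.rpow_add hξ0]; congr 1; ring
      have e3 : ξ ^ α * laguerre n α (2 * (Y * ξ)) =
          ∑ k ∈ Finset.range (n + 1), c k * ξ ^ (α + k) := by
        rw [laguerre, Finset.mul_sum]
        refine Finset.sum_congr rfl fun k _ => ?_
        rw [Real.rpow_add hξ0, Real.rpow_natCast, hc, ← mul_assoc 2, mul_pow (2 * Y)]
        ring
      rw [← e3, ← e2, ← e1, Real.mul_rpow hY0.le hξ0.le]
      ring
    have hexp : Complex.exp (2 * Real.pi * Complex.I * w * ξ) *
        conj (Complex.exp (((-(2 * Real.pi * z.re * ξ) : ℝ) : ℂ) * Complex.I)) *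
        ((Real.exp (-(Y * ξ)) : ℝ) : ℂ) = Complex.exp (-s * ξ) := by
      rw [← Complex.exp_conj, map_mul, Complex.conj_ofReal, Complex.conj_I, Complex.ofReal_exp,
        ← Complex.exp_add, ← Complex.exp_add]
      congr 1
      have hz : (z : ℂ) = z.re + z.im * Complex.I := (Complex.re_add_im (z : ℂ)).symm
      rw [hs, hz, hY]
      push_cast
      linear_combination (-(2 * Real.pi * z.im * ξ) : ℂ) * Complex.I_sq
    have hk : kernelFn n α z.re z.im ξ = ((√z.im : ℝ) : ℂ) *
        Complex.exp (((-(2 * Real.pi * z.re * ξ) : ℝ) : ℂ) * Complex.I) * (((√(2 * Real.pi) : ℝ) : ℂ) *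
          (((Y * ξ) ^ (α / 2) * Real.exp (-(Y * ξ)) * laguerre n α (2 * (Y * ξ)) : ℝ) : ℂ)) := by
      rw [kernelFn, windowHat, ← mul_assoc (2 * Real.pi), ← hY, psiHat_of_pos n α (by positivity),
        eval_laguerrePoly]
    have hsum : ∑ k ∈ Finset.range (n + 1), (c k : ℂ) *
        (((ξ ^ (α + k) : ℝ) : ℂ) * Complex.exp (-s * ξ)) =
        ((∑ k ∈ Finset.range (n + 1), c k * ξ ^ (α + k) : ℝ) : ℂ) * Complex.exp (-s * ξ) := by
      rw [Complex.ofReal_sum, Finset.sum_mul]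
      exact Finset.sum_congr rfl fun k _ => by push_cast; ring
    rw [hsum, ← mul_assoc, ← Complex.ofReal_mul, ← hreal, ← hexp, expVec, hξ1, expFn, hk]
    simp only [map_mul, Complex.conj_ofReal]
    push_cast
    ring
  have hint : ∀ k : ℕ, IntegrableOn
      (fun ξ : ℝ => ((ξ ^ (α + k) : ℝ) : ℂ) * Complex.exp (-s * ξ)) (Ioi 0) := fun k =>
    integrableOn_rpow_mul_cexp_neg (by
      have : (0 : ℝ) ≤ k := k.cast_nonneg
      linarith) hsre
  have hratio : ((w : ℂ) + conj (z : ℂ)) / (w + z) = -(2 * Y / s) + 1 := by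
    have h2 := add_coe_ne_zero w z
    have hz : (z : ℂ) - conj (z : ℂ) = 2 * z.im * Complex.I := by
      rw [Complex.sub_conj]
      push_cast
      rfl
    have hpi : (Real.pi : ℂ) ≠ 0 := by exact_mod_cast Real.pi_ne_zero
    have hI := Complex.I_ne_zero
    rw [div_eq_iff h2, hs, hY]
    push_cast
    field_simp
    linear_combination (-Complex.I) * hz - (2 * (z.im : ℂ)) * Complex.I_sq
  rw [h1, integral_const_mul, integral_finsetSum _ fun k _ => (hint k).const_mul _]
  simp only [integral_const_mul]
  have hterm : ∑ k ∈ Finset.range (n + 1), (c k : ℂ) *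
        ∫ ξ in Ioi (0 : ℝ), ((ξ ^ (α + k) : ℝ) : ℂ) * Complex.exp (-s * ξ) =
      (Real.Gamma (n + α + 1) / n.factorial : ℝ) * s ^ (-((α + 1 : ℝ) : ℂ)) *
        (-(2 * Y / s) + 1) ^ n := ?_
  · rw [hterm, expTransform, hratio, ← hs, ← hY]
    ring
  rw [add_pow, Finset.mul_sum]
  refine Finset.sum_congr rfl fun k hk => ?_
  have hkn : k ≤ n := by simpa [Nat.lt_succ_iff] using hk
  rw [integral_rpow_mul_cexp_neg (by
      have : (0 : ℝ) ≤ k := k.cast_nonneg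
      linarith) hsre]
  have hpow : s ^ (-((α + k + 1 : ℝ) : ℂ)) = s ^ (-((α + 1 : ℝ) : ℂ)) * (s ^ k)⁻¹ := by
    rw [← Complex.cpow_natCast, ← Complex.cpow_neg, ← Complex.cpow_add _ _ hs0]
    congr 1
    push_cast
    ring
  have hG : Real.Gamma (k + α + 1) ≠ 0 := (Real.Gamma_pos_of_pos (by positivity)).ne'
  have hGC : (Real.Gamma (k + α + 1) : ℂ) ≠ 0 := by exact_mod_cast hG
  have hch : (n.choose k : ℂ) = n.factorial / (k.factorial * (n - k).factorial) :=
    Nat.cast_choose ℂ hkn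
  have f1 : (n.factorial : ℂ) ≠ 0 := by exact_mod_cast n.factorial_ne_zero
  have f2 : (k.factorial : ℂ) ≠ 0 := by exact_mod_cast k.factorial_ne_zero
  have f3 : ((n - k).factorial : ℂ) ≠ 0 := by exact_mod_cast (n - k).factorial_ne_zero
  rw [hpow, hch, hc, show α + k + 1 = k + α + 1 by ring, neg_pow (2 * (Y : ℂ) / s),
    div_pow, mul_pow (2 : ℂ)]
  beta_reduce
  push_cast
  rw [mul_pow]
  field_simp
  simp

/-- The exponentials span a dense subspace: orthogonality to those on a horizontal line says that
a Fourier integral vanishes. -/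
theorem span_expVec_dense :
    (Submodule.span ℂ (range (expVec hα))).topologicalClosure = ⊤ := by
  rw [Submodule.topologicalClosure_eq_top_iff, Submodule.eq_bot_iff]
  intro φ hφ
  have h0 : ∀ w, ⟪expVec hα w, φ⟫_ℂ = 0 := fun w =>
    (Submodule.mem_orthogonal _ _).mp hφ _ (Submodule.subset_span ⟨w, rfl⟩)
  set g : ℝ → ℂ := (Ioi (0 : ℝ)).indicator fun ξ => φ ξ * conj (expFn α UpperHalfPlane.I ξ) with hg
  have hkm : Measurable fun ξ => conj (expFn α UpperHalfPlane.I ξ) :=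
    Complex.continuous_conj.measurable.comp (measurable_expFn _)
  have hks : MemLp (fun ξ => conj (expFn α UpperHalfPlane.I ξ)) 2 (volume.restrict (Ioi 0)) :=
    (memLp_expFn hα UpperHalfPlane.I).of_le hkm.aestronglyMeasurable (ae_of_all _ fun ξ => by simp)
  have hg1 : Integrable g :=
    (integrable_indicator_iff measurableSet_Ioi).mpr ((Lp.memLp φ).integrable_mul hks)
  obtain ⟨M, hM⟩ : ∃ M, ∀ ξ, 0 < ξ → ‖expFn α UpperHalfPlane.I ξ‖ ≤ M := by
    obtain ⟨M, hM⟩ := exists_bound_rpow_mul_exp_mul_eval (show 0 ≤ α / 2 by positivity) 1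
    refine ⟨M, fun ξ hξ => ?_⟩
    have h1 := hM ξ hξ
    have hM0 : 0 ≤ M := nonneg_of_mul_nonneg_left ((abs_nonneg _).trans h1) (Real.exp_pos _)
    rw [Polynomial.eval_one, mul_one, abs_of_nonneg (by positivity)] at h1
    rw [norm_expFn _ hξ]
    have h2 : Real.exp (-(2 * Real.pi * UpperHalfPlane.I.im) * ξ) ≤ Real.exp (-ξ) := by
      apply Real.exp_le_exp.mpr
      rw [UpperHalfPlane.I_im]
      nlinarith [Real.pi_gt_three]
    calc _ ≤ ξ ^ (α / 2) * Real.exp (-ξ) := by gcongr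
      _ ≤ M * Real.exp (-(ξ / 2)) := h1
      _ ≤ M := mul_le_of_le_one_right hM0 (Real.exp_le_one_iff.mpr (by linarith))
  have hg2 : MemLp g 2 := by
    rw [hg, memLp_indicator_iff_restrict measurableSet_Ioi]
    refine (Lp.memLp φ).of_le_mul (c := M)
      ((Lp.aestronglyMeasurable φ).mul hkm.aestronglyMeasurable) ?_
    filter_upwards [ae_restrict_mem measurableSet_Ioi] with ξ hξ
    rw [norm_mul, mul_comm, RCLike.norm_conj]
    gcongr
    exact hM ξ hξ
  have hF : ∀ x, 𝓕⁻ g x = 0 := fun x => by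
    have hw := h0 ⟨⟨-x, 1⟩, one_pos⟩
    rw [L2.inner_def] at hw
    rw [Real.fourierInv_eq', ← hw, ← integral_indicator measurableSet_Ioi]
    refine integral_congr_ae ?_
    filter_upwards [(ae_restrict_iff' measurableSet_Ioi).mp
      (memLp_expFn hα ⟨⟨-x, 1⟩, one_pos⟩).coeFn_toLp] with ξ hξ1
    by_cases hξ : ξ ∈ Ioi (0 : ℝ)
    · rw [indicator_of_mem hξ, hg, indicator_of_mem hξ, expVec, hξ1 hξ,
        RCLike.inner_apply (𝕜 := ℂ), expFn,
        expFn, map_mul, map_mul, Complex.conj_ofReal, ← Complex.exp_conj, ← Complex.exp_conj]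
      have e : Complex.exp (conj (2 * Real.pi * Complex.I * (⟨-x, 1⟩ : ℂ) * ξ)) =
          Complex.exp (((2 * Real.pi * inner ℝ ξ x : ℝ) : ℂ) * Complex.I) *
            Complex.exp (conj (2 * Real.pi * Complex.I * Complex.I * ξ)) := by
        rw [← Complex.exp_add]
        congr 1
        apply Complex.ext <;> simp
        ring
      change _ = φ ξ * (((ξ ^ (α / 2) : ℝ) : ℂ) *
        Complex.exp (conj (2 * Real.pi * Complex.I * (⟨-x, 1⟩ : ℂ) * ξ)))
      rw [e, smul_eq_mul, UpperHalfPlane.coe_I]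
      ring
    · rw [indicator_of_notMem hξ, hg, indicator_of_notMem hξ, smul_zero]
  have h1 := ae_eq_zero_of_fourierInv_eq_zero hg1 hg2 hF
  refine (Lp.eq_zero_iff_ae_eq_zero).mpr ?_
  filter_upwards [ae_restrict_of_ae h1, ae_restrict_mem measurableSet_Ioi] with ξ h2 hξ
  have hξ0 : (0 : ℝ) < ξ := hξ
  have hne : expFn α UpperHalfPlane.I ξ ≠ 0 := by
    rw [← norm_ne_zero_iff, norm_expFn _ hξ0]
    positivity
  simpa [hg, indicator_of_mem hξ, hne] using h2

end Exponentials

/-! ### Invariance of the wavelet space -/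

section Invariance

open scoped InnerProductSpace ComplexConjugate ENNReal

/-- The transforms of exponentials are permuted, up to constants, by the projective action. -/
theorem autFactor_mul_expTransform (n : ℕ) (α : ℝ) (m : SL(2, ℝ)) (w : ℍ) :
    ∃ (c : ℂ) (w' : ℍ), ∀ z, autFactor (2 * n + α + 1) m z * expTransform n α w (m • z) =
      c * expTransform n α w' z := by
  -- `w'` is chosen so that `m • z + w = D (z + w') / (m₁₀ z + m₁₁)` with `D` independent of `z`.
  set m' : SL(2, ℝ) := ⟨!![m 1 1, m 0 1; m 1 0, m 0 0], by
    rw [Matrix.det_fin_two_of]; linarith [det_SL m]⟩ with hm'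
  set w' : ℍ := m' • w with hw'
  set D : ℂ := mden m' w with hD
  have hD0 : D ≠ 0 := mden_ne_zero m' w
  have hDw : D * w' = (m 1 1 : ℂ) * w + (m 0 1 : ℂ) := by
    rw [hw', coe_smul_SL, ← hD, mul_div_cancel₀ _ hD0]
    rfl
  have hDe : D = (m 1 0 : ℂ) * w + (m 0 0 : ℂ) := rfl
  have hdet : (m 0 0 : ℂ) * m 1 1 - (m 0 1 : ℂ) * m 1 0 = 1 := by exact_mod_cast det_SL m
  have hadd : ∀ z : ℍ, (w : ℂ) + (m • z : ℍ) = D * (w' + z) / mden m z := fun z => by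
    have h := mden_ne_zero m z
    rw [coe_smul_SL, eq_div_iff h, mul_add D, hDw, hDe, add_mul, div_mul_cancel₀ _ h, mden]
    ring
  have hconj : ∀ z : ℍ, (w : ℂ) + conj ((m • z : ℍ) : ℂ) =
      D * (w' + conj (z : ℂ)) / conj (mden m z) :=
    fun z => by
      have h : conj (mden m z) ≠ 0 := by simpa using mden_ne_zero m z
      rw [coe_smul_SL, eq_div_iff h, mul_add D, hDw, hDe, add_mul, map_div₀,
        div_mul_cancel₀ _ h, mden]
      simp only [map_add, map_mul, Complex.conj_ofReal]
      ring
  set A : ℍ → ℂ := fun z => -(2 * Real.pi * Complex.I * (w + (m • z : ℍ))) with hA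
  set B : ℍ → ℂ := fun z => -(2 * Real.pi * Complex.I * (w' + z)) with hB
  have hAre : ∀ z, 0 < (A z).re := fun z => re_exponent_pos w (m • z)
  have hBre : ∀ z, 0 < (B z).re := fun z => re_exponent_pos w' z
  have hA0 : ∀ z, A z ≠ 0 := fun z h => by have := hAre z; simp [h] at this
  have hB0 : ∀ z, B z ≠ 0 := fun z h => by have := hBre z; simp [h] at this
  have hcoe := UpperHalfPlane.continuous_coe
  have hsmul : Continuous fun z : ℍ => m • z := by fun_prop
  have hAc : Continuous A :=
    (continuous_const.mul (continuous_const.add (hcoe.comp hsmul))).neg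
  have hBc : Continuous B := by fun_prop
  set h : ℍ → ℂ := fun z => mlog m z - (Real.log ‖mden m z‖ : ℂ) - Complex.log (A z) +
    Complex.log (B z) with hh
  have hn0 : ∀ z, ‖mden m z‖ ≠ 0 := fun z => norm_ne_zero_iff.mpr (mden_ne_zero m z)
  have hc : Continuous h := by
    refine (((continuous_mlog m).sub (Complex.continuous_ofReal.comp
      ((continuous_mden m).norm.log hn0))).sub (hAc.clog fun z => Or.inl (hAre z))).add
      (hBc.clog fun z => Or.inl (hBre z))
  have hlogn : ∀ z, Complex.exp (Real.log ‖mden m z‖ : ℂ) = (‖mden m z‖ : ℂ) := fun z => by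
    rw [← Complex.ofReal_exp, Real.exp_log (norm_pos_iff.mpr (mden_ne_zero m z))]
  have hexp : ∀ z, Complex.exp (h z) = D⁻¹ := fun z => by
    have h1 : ((‖mden m z‖ : ℝ) : ℂ) ≠ 0 := by exact_mod_cast hn0 z
    have h2 := mden_ne_zero m z
    have h3 : A z = D * B z / mden m z := by
      simp only [hA, hB, hadd]
      ring
    have h4 := hB0 z
    simp only [hh]
    rw [Complex.exp_add, Complex.exp_sub, Complex.exp_sub, exp_mlog, hlogn,
      Complex.exp_log (hA0 z), Complex.exp_log h4, h3]
    field_simp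
  have hconst : ∀ z, h z = h UpperHalfPlane.I := fun z =>
    eq_of_exp_eq hc (fun z z' => by rw [hexp, hexp]) z _
  refine ⟨Complex.exp (h UpperHalfPlane.I * (α + 1)), w', fun z => ?_⟩
  have hy := z.im_pos
  have hj := mden_ne_zero m z
  have hjc : conj (mden m z) ≠ 0 := by simpa using hj
  have hn : 0 < ‖mden m z‖ := norm_pos_iff.mpr hj
  have haut : autFactor (2 * n + α + 1) m z =
      (((‖mden m z‖ : ℝ) : ℂ) / mden m z) ^ (2 * n) * Complex.exp (mlog m z * (α + 1)) := by
    rw [autFactor_eq_exp, ← exp_mlog, ← Complex.exp_nat_mul, ← Complex.exp_add]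
    congr 1
    push_cast
    ring
  have him : (((2 * Real.pi * (m • z).im) ^ ((α + 1) / 2) : ℝ) : ℂ) =
      (((2 * Real.pi * z.im) ^ ((α + 1) / 2) : ℝ) : ℂ) *
        Complex.exp (-(Real.log ‖mden m z‖ : ℂ) * (α + 1)) := by
    have e : (2 * Real.pi * (m • z).im) ^ ((α + 1) / 2) = (2 * Real.pi * z.im) ^ ((α + 1) / 2) *
        Real.exp (-Real.log ‖mden m z‖ * (α + 1)) := by
      rw [im_smul_SL, ← mul_div_assoc, Real.div_rpow (by positivity) (by positivity), div_eq_mul_inv,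
        ← Real.rpow_neg (by positivity), ← Real.rpow_natCast, ← Real.rpow_mul hn.le,
        Real.rpow_def_of_pos hn]
      congr 2
      push_cast
      ring
    rw [e]
    push_cast
    rfl
  have hcp : ∀ s : ℂ, s ≠ 0 → s ^ (-((α + 1 : ℝ) : ℂ)) = Complex.exp (-Complex.log s * (α + 1)) :=
    fun s hs => by
      rw [Complex.cpow_def_of_ne_zero hs]
      congr 1
      push_cast
      ring
  have hw'z := add_coe_ne_zero w' z
  have hrat : (((‖mden m z‖ : ℝ) : ℂ) / mden m z) ^ (2 * n) *
      ((w + conj ((m • z : ℍ) : ℂ)) / (w + (m • z : ℍ))) ^ n =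
      ((w' + conj (z : ℂ)) / (w' + z)) ^ n := by
    rw [pow_mul, ← mul_pow]
    congr 1
    have hnn : ((‖mden m z‖ : ℝ) : ℂ) ^ 2 = mden m z * conj (mden m z) := by
      rw [Complex.mul_conj, Complex.normSq_eq_norm_sq]
      push_cast
      rfl
    rw [hadd, hconj, div_pow, hnn]
    field_simp
  have hprod : Complex.exp (mlog m z * (α + 1)) *
      Complex.exp (-(Real.log ‖mden m z‖ : ℂ) * (α + 1)) *
      Complex.exp (-Complex.log (A z) * (α + 1)) =
      Complex.exp (h UpperHalfPlane.I * (α + 1)) * Complex.exp (-Complex.log (B z) * (α + 1)) := by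
    rw [← hconst z, ← Complex.exp_add, ← Complex.exp_add, ← Complex.exp_add]
    congr 1
    simp only [hh]
    ring
  rw [expTransform, expTransform, haut, him, ← hrat, hcp _ (hA0 z), hcp _ (hB0 z)]
  linear_combination ((((2 * Real.pi * z.im) ^ ((α + 1) / 2) : ℝ) : ℂ) *
    (((‖mden m z‖ : ℝ) : ℂ) / mden m z) ^ (2 * n) *
      ((w + conj ((m • z : ℍ) : ℂ)) / (w + (m • z : ℍ))) ^ n) * hprod

variable (n : ℕ) {α : ℝ} (hα : 0 < α)

theorem tau_freqTransform_expVec (g : SL(2, ℝ)) (w : ℍ) : ∃ φ : FreqSpace,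
    freqTransform n hα φ = tau n α g (freqTransform n hα (expVec hα w)) := by
  obtain ⟨c, w', h⟩ := autFactor_mul_expTransform n α g⁻¹ w
  refine ⟨c • expVec hα w', funext fun z => ?_⟩
  rw [freqTransform_smul, Pi.smul_apply, freqTransform_expVec, tau_eq, freqTransform_expVec,
    smul_eq_mul, mul_left_comm, ← h]
  ring

theorem tau_add (g : SL(2, ℝ)) (F G : ℍ → ℂ) :
    tau n α g (F + G) = tau n α g F + tau n α g G :=
  funext fun _ => mul_add _ _ _

theorem tau_smul (g : SL(2, ℝ)) (c : ℂ) (F : ℍ → ℂ) :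
    tau n α g (c • F) = c • tau n α g F :=
  funext fun _ => mul_left_comm _ _ _

theorem norm_eq_of_freqTransform_eq_tau {g : SL(2, ℝ)} {φ φ' : FreqSpace}
    (h : freqTransform n hα φ' = tau n α g (freqTransform n hα φ)) : ‖φ'‖ = ‖φ‖ := by
  have h1 : l2NormSq (freqTransform n hα φ') = l2NormSq (freqTransform n hα φ) := by
    rw [l2NormSq, h]
    simp only [norm_tau]
    exact (measurePreserving_smul_SL g⁻¹).integral_comp
      (Homeomorph.smul g⁻¹).measurableEmbedding fun z => ‖freqTransform n hα φ z‖ ^ 2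
  rw [l2NormSq_freqTransform, l2NormSq_freqTransform] at h1
  have h2 := mul_left_cancel₀ (admissibilityConst_pos n hα).ne' h1
  exact (pow_left_inj₀ (norm_nonneg _) (norm_nonneg _) two_ne_zero).mp h2

/-- The wavelet space is invariant under the projective action. -/
theorem exists_freqTransform_eq_tau (g : SL(2, ℝ)) (φ : FreqSpace) : ∃ φ' : FreqSpace,
    freqTransform n hα φ' = tau n α g (freqTransform n hα φ) := by
  let V : Submodule ℂ FreqSpace :=
    { carrier := {φ | ∃ φ' : FreqSpace, freqTransform n hα φ' = tau n α g (freqTransform n hα φ)}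
      add_mem' := by
        rintro φ₁ φ₂ ⟨ψ₁, h₁⟩ ⟨ψ₂, h₂⟩
        exact ⟨ψ₁ + ψ₂, by rw [freqTransform_add, freqTransform_add, tau_add, h₁, h₂]⟩
      zero_mem' := ⟨0, by
        rw [← zero_smul ℂ (0 : FreqSpace), freqTransform_smul, tau_smul, zero_smul, zero_smul]⟩
      smul_mem' := by
        rintro c φ ⟨ψ, h⟩
        exact ⟨c • ψ, by rw [freqTransform_smul, freqTransform_smul, tau_smul, h]⟩ }
  have hcl : IsClosed (V : Set FreqSpace) := by
    refine isClosed_of_closure_subset fun φ hφ => ?_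
    obtain ⟨u, hu, hlim⟩ := mem_closure_iff_seq_limit.mp hφ
    choose v hv using hu
    -- The preimages form a Cauchy sequence because the action preserves norms.
    have hdist : ∀ i j, dist (v i) (v j) = dist (u i) (u j) := fun i j => by
      rw [dist_eq_norm, dist_eq_norm]
      refine norm_eq_of_freqTransform_eq_tau n hα (g := g) ?_
      rw [sub_eq_add_neg, sub_eq_add_neg, ← neg_one_smul ℂ, ← neg_one_smul ℂ (u j),
        freqTransform_add, freqTransform_add, freqTransform_smul, freqTransform_smul, tau_add,
        tau_smul, hv, hv]
    have hcau : CauchySeq v := by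
      have := hlim.cauchySeq
      rw [Metric.cauchySeq_iff'] at this ⊢
      simpa only [hdist] using this
    obtain ⟨φ', hφ'⟩ := cauchySeq_tendsto_of_complete hcau
    have hpt : ∀ (z : ℍ) {a : ℕ → FreqSpace} {b : FreqSpace},
        Filter.Tendsto a Filter.atTop (nhds b) → Filter.Tendsto
          (fun i => freqTransform n hα (a i) z) Filter.atTop (nhds (freqTransform n hα b z)) :=
      fun z a b hab => ((innerSL ℂ (kernelVec n hα z)).continuous.tendsto b).comp hab
    refine ⟨φ', funext fun z => tendsto_nhds_unique (hpt z hφ') ?_⟩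
    simp only [hv, tau_eq]
    exact (hpt (g⁻¹ • z) hlim).const_mul _
  have htop : (⊤ : Submodule ℂ FreqSpace) ≤ V := by
    rw [← span_expVec_dense hα]
    refine Submodule.topologicalClosure_minimal _ (Submodule.span_le.mpr ?_) hcl
    rintro _ ⟨w, rfl⟩
    exact tau_freqTransform_expVec n hα g w
  exact htop trivial

/-- The projective action on the frequency side, by isometries. -/
theorem exists_tauOp : ∃ U : SL(2, ℝ) → FreqSpace →L[ℂ] FreqSpace,
    (∀ g φ, freqTransform n hα (U g φ) = tau n α g (freqTransform n hα φ)) ∧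
      ∀ g x y, ⟪U g x, U g y⟫_ℂ = ⟪x, y⟫_ℂ := by
  choose u hu using exists_freqTransform_eq_tau n hα
  let L : SL(2, ℝ) → FreqSpace →ₗᵢ[ℂ] FreqSpace := fun g =>
    { toFun := u g
      map_add' := fun φ φ' => freqTransform_injective n hα (by
        rw [freqTransform_add, hu, hu, hu, freqTransform_add, tau_add])
      map_smul' := fun c φ => freqTransform_injective n hα (by
        rw [RingHom.id_apply, freqTransform_smul, hu, hu, freqTransform_smul, tau_smul])
      norm_map' := fun φ => norm_eq_of_freqTransform_eq_tau n hα (hu g φ) }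
  exact ⟨fun g => (L g).toContinuousLinearMap, hu, fun g x y => (L g).inner_map_map x y⟩

end Invariance

/-! ### Averaging over a fundamental domain -/

section Averaging

open scoped InnerProductSpace ENNReal

/-- A discrete subspace of the second countable space `PSL(2, ℝ)` is countable. -/
theorem countable_of_discrete_PSL (Γ : Subgroup PSL(2, ℝ)) [DiscreteTopology Γ] : Countable Γ := by
  have : SecondCountableTopology (Matrix (Fin 2) (Fin 2) ℝ) :=
    inferInstanceAs (SecondCountableTopology (Fin 2 → Fin 2 → ℝ))
  have h1 : SecondCountableTopology SL(2, ℝ) :=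
    TopologicalSpace.Subtype.secondCountableTopology
      {A : Matrix (Fin 2) (Fin 2) ℝ | A.det = 1}
  have h2 : SecondCountableTopology PSL(2, ℝ) :=
    (QuotientGroup.isOpenQuotientMap_mk
      (N := Subgroup.center SL(2, ℝ))).isQuotientMap.secondCountableTopology
      QuotientGroup.isOpenMap_coe
  exact countable_of_Lindelof_of_discrete

variable {Γ : Subgroup PSL(2, ℝ)} {rep : Γ → SL(2, ℝ)}

theorem rep_inv_smul (hrep : ∀ γ : Γ, ((rep γ : SL(2, ℝ)) : PSL(2, ℝ)) = γ) (γ : Γ) (z : ℍ) :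
    (rep γ)⁻¹ • z = γ⁻¹ • z := by
  rw [← psl_mk_smul, QuotientGroup.mk_inv, hrep]
  rfl

theorem tau_one (n : ℕ) (α : ℝ) (F : ℍ → ℂ) : tau n α 1 F = F := by
  funext z
  simp [tau_eq, autFactor, mden]

/-- Unfolding: the integral over `ℍ` of an orbit sum is an integral over a fundamental domain. -/
theorem lintegral_unfold [DiscreteTopology Γ]
    (hrep : ∀ γ : Γ, ((rep γ : SL(2, ℝ)) : PSL(2, ℝ)) = γ)
    {Ω : Set ℍ} (hΩ : IsFundamentalDomain Γ Ω hypMeasure) {f : ℍ → ℝ≥0∞} (hf : Measurable f) :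
    ∫⁻ z, f z ∂hypMeasure = ∫⁻ z in Ω, ∑' γ : Γ, f ((rep γ)⁻¹ • z) ∂hypMeasure := by
  have := countable_of_discrete_PSL Γ
  have hsm : ∀ (γ : Γ) (z : ℍ), rep γ • z = γ • z := fun γ z => by
    rw [← psl_mk_smul, hrep]
    rfl
  have hmp : ∀ γ : Γ, MeasurePreserving (fun z : ℍ => γ • z) hypMeasure hypMeasure := fun γ => by
    simp only [← hsm]
    exact measurePreserving_smul_SL _
  have : MeasurableConstSMul Γ ℍ := ⟨fun γ => (hmp γ).measurable⟩
  have : SMulInvariantMeasure Γ ℍ hypMeasure :=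
    ⟨fun γ s hs => (hmp γ).measure_preimage hs.nullMeasurableSet⟩
  simp only [rep_inv_smul hrep]
  rw [hΩ.lintegral_eq_tsum']
  exact (lintegral_tsum fun γ => (hf.comp (hmp γ⁻¹).measurable).aemeasurable).symm

variable (n : ℕ) {α : ℝ} (hα : 0 < α) {U : SL(2, ℝ) → FreqSpace →L[ℂ] FreqSpace}

/-- Unfolding the norm of a window over the fundamental domain produces the frame sums at the
wavelets. -/
theorem admissibilityConst_mul_norm_sq [DiscreteTopology Γ]
    (hrep : ∀ γ : Γ, ((rep γ : SL(2, ℝ)) : PSL(2, ℝ)) = γ)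
    {Ω : Set ℍ} (hΩ : IsFundamentalDomain Γ Ω hypMeasure)
    (hU : ∀ g φ, freqTransform n hα (U g φ) = tau n α g (freqTransform n hα φ)) (h : FreqSpace) :
    ENNReal.ofReal (admissibilityConst (psi n α hα) * ‖h‖ ^ 2) =
      ∫⁻ z in Ω, ∑' γ : Γ, ENNReal.ofReal (‖⟪U (rep γ) h, kernelVec n hα z⟫_ℂ‖ ^ 2) ∂hypMeasure := by
  have h1 := lintegral_enorm_sq_freqTransform n hα h
  rw [lintegral_unfold hrep hΩ ((measurable_freqTransform n hα h).enorm.pow_const 2)] at h1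
  rw [ENNReal.ofReal_mul (admissibilityConst_pos n hα).le, ENNReal.ofReal_pow (norm_nonneg _),
    ofReal_norm, ← h1]
  refine lintegral_congr fun z => tsum_congr fun γ => ?_
  have h2 : freqTransform n hα (U (rep γ) h) z = ⟪kernelVec n hα z, U (rep γ) h⟫_ℂ := rfl
  rw [norm_inner_symm, ← h2, hU, norm_tau, ENNReal.ofReal_pow (norm_nonneg _), ofReal_norm]

theorem exists_phase (hU : ∀ g φ, freqTransform n hα (U g φ) = tau n α g (freqTransform n hα φ))
    {g g' g'' : SL(2, ℝ)} (h : ((g * g' : SL(2, ℝ)) : PSL(2, ℝ)) = g'') :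
    ∃ c : ℂ, ‖c‖ = 1 ∧ ∀ φ, U g (U g' φ) = c • U g'' φ := by
  obtain ⟨c, hc, h1⟩ := tau_tau n α g g'
  obtain ⟨c', hc', h2⟩ := tau_congr n α h.symm
  refine ⟨c * c', by rw [norm_mul, hc, hc', one_mul], fun φ => freqTransform_injective n hα ?_⟩
  rw [hU, hU, freqTransform_smul, hU, h1, h2, smul_smul]

theorem exists_perm_phase (hrep : ∀ γ : Γ, ((rep γ : SL(2, ℝ)) : PSL(2, ℝ)) = γ)
    (hU : ∀ g φ, freqTransform n hα (U g φ) = tau n α g (freqTransform n hα φ)) (φ : FreqSpace)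
    (j : Γ) : ∃ (p : Equiv.Perm Γ) (c : Γ → ℂ), ∀ i, ‖c i‖ = 1 ∧
      U (rep j) (U (rep i) φ) = c i • U (rep (p i)) φ := by
  have h : ∀ i : Γ, ((rep j * rep i : SL(2, ℝ)) : PSL(2, ℝ)) = rep (j * i) := fun i => by
    rw [QuotientGroup.mk_mul, hrep, hrep, hrep]
    rfl
  choose c hc using fun i => exists_phase n hα hU (h i)
  exact ⟨Equiv.mulLeft j, c, fun i => ⟨(hc i).1, (hc i).2 φ⟩⟩

/-- A frame yields a Parseval frame whose window has norm at most one, so unfolding bounds the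
volume from above. -/
theorem volume_le_of_isFrame [DiscreteTopology Γ]
    (hrep : ∀ γ : Γ, ((rep γ : SL(2, ℝ)) : PSL(2, ℝ)) = γ)
    {Ω : Set ℍ} (hΩ : IsFundamentalDomain Γ Ω hypMeasure)
    {F : ℍ → ℂ} (hF : F ∈ waveletSpace (psi n α hα))
    (hframe : IsFrame (waveletSpace (psi n α hα)) (fun γ : Γ => tau n α (rep γ) F)) :
    (hypMeasure Ω).toReal ≤ admissibilityConst (psi n α hα) / ‖psi n α hα‖ ^ 2 := by
  have hC := admissibilityConst_pos n hα
  have hN := norm_psi_pos n hα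
  set C := admissibilityConst (psi n α hα)
  rw [waveletSpace_psi] at hF hframe
  obtain ⟨φ, rfl⟩ := hF
  obtain ⟨U, hU, hUi⟩ := exists_tauOp n hα
  obtain ⟨A, B, hA, hB, hAB⟩ := hframe
  have hl2 : ∀ x (γ : Γ),
      ‖l2Inner (freqTransform n hα x) (tau n α (rep γ) (freqTransform n hα φ))‖ ^ 2
      = C ^ 2 * ‖⟪U (rep γ) φ, x⟫_ℂ‖ ^ 2 := fun x γ => by
    rw [← hU, l2Inner_freqTransform, norm_mul, mul_pow, Complex.norm_real, Real.norm_of_nonneg hC.le]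
  obtain ⟨S, R, -, -, -, hpars, hle⟩ := exists_parseval_window (U := fun γ : Γ => U (rep γ)) (f := φ)
    (A := A / C) (B := B / C) (fun γ => hUi (rep γ)) (exists_perm_phase n hα hrep hU φ)
    (by positivity) fun x => by
      obtain ⟨h1, h2, h3⟩ := hAB _ ⟨x, rfl⟩
      simp only [hl2, l2NormSq_freqTransform] at h1 h2 h3
      rw [tsum_mul_left] at h2 h3
      refine ⟨(summable_mul_left_iff (by positivity)).mp h1, ?_, ?_⟩
      · rw [div_mul_eq_mul_div, div_le_iff₀ hC]
        refine le_of_mul_le_mul_left (a := C) ?_ hC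
        calc C * (A * ‖x‖ ^ 2) = A * (C * ‖x‖ ^ 2) := by ring
          _ ≤ _ := h2
          _ = _ := by ring
      · rw [div_mul_eq_mul_div, le_div_iff₀ hC]
        refine le_of_mul_le_mul_left (a := C) ?_ hC
        calc _ = C ^ 2 * ∑' γ : Γ, ‖⟪U (rep γ) φ, x⟫_ℂ‖ ^ 2 := by ring
          _ ≤ _ := h3
          _ = _ := by ring
  have h := admissibilityConst_mul_norm_sq n hα hrep hΩ hU (R φ)
  have hz : ∀ z, ∑' γ : Γ, ENNReal.ofReal (‖⟪U (rep γ) (R φ), kernelVec n hα z⟫_ℂ‖ ^ 2) =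
      ENNReal.ofReal (‖psi n α hα‖ ^ 2) := fun z => by
    rw [← ENNReal.ofReal_tsum_of_nonneg (fun _ => by positivity) (hpars _).summable,
      (hpars _).tsum_eq, norm_sq_kernelVec]
  simp only [hz] at h
  rw [setLIntegral_const] at h
  have h2 := congrArg ENNReal.toReal h
  rw [ENNReal.toReal_mul, ENNReal.toReal_ofReal (by positivity), ENNReal.toReal_ofReal hN.le] at h2
  rw [le_div_iff₀ hN, mul_comm, ← h2]
  exact mul_le_of_le_one_right hC.le (pow_le_one₀ (norm_nonneg _) hle)

/-- A Riesz sequence yields an orthonormal orbit, so unfolding and Bessel's inequality bound the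
volume from below. -/
theorem le_volume_of_isRieszSequence [DiscreteTopology Γ]
    (hrep : ∀ γ : Γ, ((rep γ : SL(2, ℝ)) : PSL(2, ℝ)) = γ)
    {Ω : Set ℍ} (hΩ : IsFundamentalDomain Γ Ω hypMeasure) (hfin : hypMeasure Ω < ⊤)
    {F : ℍ → ℂ} (hF : F ∈ waveletSpace (psi n α hα))
    (hriesz : IsRieszSequence (fun γ : Γ => tau n α (rep γ) F)) :
    admissibilityConst (psi n α hα) / ‖psi n α hα‖ ^ 2 ≤ (hypMeasure Ω).toReal := by
  have hC := admissibilityConst_pos n hα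
  have hN := norm_psi_pos n hα
  set C := admissibilityConst (psi n α hα)
  rw [waveletSpace_psi] at hF
  obtain ⟨φ, rfl⟩ := hF
  obtain ⟨U, hU, hUi⟩ := exists_tauOp n hα
  obtain ⟨A, B, hA, hB, hAB⟩ := hriesz
  have hsum : ∀ c : Γ →₀ ℂ,
      (fun z => c.sum fun γ x => x * tau n α (rep γ) (freqTransform n hα φ) z) =
      freqTransform n hα (c.sum fun γ x => x • U (rep γ) φ) := fun c => funext fun z => by
    simp only [← hU, Finsupp.sum, freqTransform, inner_sum, inner_smul_right]
  simp only [hsum, l2NormSq_freqTransform] at hAB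
  have hphase : ∃ c : ℂ, ‖c‖ = 1 ∧ φ = c • U (rep 1) φ := by
    obtain ⟨c, hc, h⟩ := tau_congr n α (g := rep 1) (g' := 1) (by rw [hrep]; rfl)
    refine ⟨c, hc, freqTransform_injective n hα ?_⟩
    rw [freqTransform_smul, hU, ← h, tau_one]
  obtain ⟨h, hh1, hbes⟩ := exists_orthonormal_window (U := fun γ : Γ => U (rep γ)) (f := φ) 1 hphase
    (fun γ => hUi (rep γ)) (exists_perm_phase n hα hrep hU φ) (A := A / C) (B := B / C)
    (by positivity) (by positivity) fun c => by
      obtain ⟨h1, h2⟩ := hAB c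
      constructor
      · rw [div_mul_eq_mul_div, div_le_iff₀ hC, mul_comm _ C]
        exact h1
      · rw [div_mul_eq_mul_div, le_div_iff₀ hC, mul_comm _ C]
        exact h2
  have hav := admissibilityConst_mul_norm_sq n hα hrep hΩ hU h
  have hz : ∀ z, ∑' γ : Γ, ENNReal.ofReal (‖⟪U (rep γ) h, kernelVec n hα z⟫_ℂ‖ ^ 2) ≤
      ENNReal.ofReal (‖psi n α hα‖ ^ 2) := fun z => by
    rw [← ENNReal.ofReal_tsum_of_nonneg (fun _ => by positivity) (hbes _).1,
      ← norm_sq_kernelVec n hα z]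
    exact ENNReal.ofReal_le_ofReal (hbes _).2
  have hle : ENNReal.ofReal C ≤ ENNReal.ofReal (‖psi n α hα‖ ^ 2) * hypMeasure Ω := by
    rw [hh1, one_pow, mul_one] at hav
    rw [hav, ← setLIntegral_const]
    exact lintegral_mono hz
  rw [div_le_iff₀ hN, mul_comm]
  have h2 := ENNReal.toReal_mono (ENNReal.mul_ne_top ENNReal.ofReal_ne_top hfin.ne) hle
  rwa [ENNReal.toReal_mul, ENNReal.toReal_ofReal hC.le, ENNReal.toReal_ofReal hN.le] at h2

end Averaging

end WaveletDensity

end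

open WaveletDensity in
theorem theorem2 (n : ℕ) (α : ℝ) (hα : 0 < α)
    (Γ : Subgroup PSL(2, ℝ)) [DiscreteTopology Γ]
    (Ω : Set ℍ) (hΩ : IsFundamentalDomain Γ Ω hypMeasure) (hfin : hypMeasure Ω < ⊤)
    (rep : Γ → SL(2, ℝ)) (hrep : ∀ γ : Γ, ((rep γ : SL(2, ℝ)) : PSL(2, ℝ)) = γ)
    (F : ℍ → ℂ) (hF : F ∈ waveletSpace (psi n α hα)) :
    admissibilityConst (psi n α hα) / ‖psi n α hα‖ ^ 2 = 2 / α ∧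
    (IsFrame (waveletSpace (psi n α hα)) (fun γ : Γ => tau n α (rep γ) F) →
      (hypMeasure Ω).toReal ≤ admissibilityConst (psi n α hα) / ‖psi n α hα‖ ^ 2) ∧
    (IsRieszSequence (fun γ : Γ => tau n α (rep γ) F) →
      admissibilityConst (psi n α hα) / ‖psi n α hα‖ ^ 2 ≤ (hypMeasure Ω).toReal) :=
  ⟨admissibilityConst_div_norm_sq n hα, volume_le_of_isFrame n hα hrep hΩ hF,
    le_volume_of_isRieszSequence n hα hrep hΩ hfin hF⟩
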